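/- Let $X=\mathbf P^1\times\mathbf P^1$, let $T\cong\mathbb C^3$, and let $\Pi F$ be the split complex supermanifold over $X$ associated with the holomorphic vector bundle $$F=T\otimes\mathcal O(1,0)\ \oplus\ T^*\otimes\mathcal O(0,1)\ \oplus\ \Theta^*,\qquad \Theta^*=\mathcal O(-1,-1),\qquad H=T\otimes\mathcal O(1,0)\oplus T^*\otimes\mathcal O(0,1).$$ Let $z_l,z_r$ be the affine coordinates on the large cell $\mathbb C^2\subset X$ and let $\theta_0,\dots,\theta_5$ and $\theta_6=\theta$ be the odd fibre coordinates of $H$ and $\Theta^*$ in the standard frames (those of $T$ and $T^*$ being dual to each other). View $\Pi F$ as a graded real supermanifold, with the additional odd coordinates $\bar\theta_j$. Let $\Omega^{0\bullet}(\Pi F)$ be its Dolbeault algebra: the global sections that are locally polynomials, with $C^\infty$ coefficients in $z_l,z_r$, in the odd variables $\theta_j,\bar\theta_j,d\bar z_i$ and the even variables $d\bar\theta_j$, with $\bar\partial=\sum_i d\bar z_i\,\partial_{\bar z_i}+\sum_j d\bar\theta_j\,\partial_{\bar\theta_j}$. The integral forms of type $(0,-k)$ are the global sections of $\mathrm{Ber}_{\mathbb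 C}\otimes\overline{\mathrm{Ber}}_{\mathbb C}\otimes\Lambda^k\overline{\mathcal T}$, where $\mathrm{Ber}_{\mathbb C}$ is the holomorphic Berezinian bundle of $\Pi F$ and $\overline{\mathcal T}$ the antiholomorphic tangent bundle; $\bar\partial$ acts on them as the divergence, and forms act on them by contraction. Let $\alpha=W\,\partial/\partial\theta$, where $W\in\Omega^{0,2}(X,\Lambda^2H^*\otimes\Theta^*)$ is any Dolbeault representative of the fundamental class, i.e. of the image of a nonzero element of $H^2(X,\mathcal O(-2,-2))\cong\mathbb C$ under the map induced by $$\mathcal O(-2,-2)\xrightarrow{\ \mathrm{id}_T\ }T\otimes T^*\otimes\mathcal O(-2,-2)\subset\Lambda^2H^*\otimes\Theta^*.$$ Put $D=\bar\partial+\alpha$, acting on $\Omega^{0\bullet}(\Pi F)$ as an odd derivation and on integral forms with $\alpha$ acting by the Lie derivative. Let $\mu=vol_{\Pi F}\otimes\bar c_{\Pi F}$, where $vol_{\Pi F}=[dz_l\,dz_r\,|\,d\theta_0\cdots d\theta_6]$ is the nonvanishing section of $\mathrm{Ber}_{\mathbb C}$, given by the same formula in the coordinates obtained from $z_l\mapsto-1/z_l$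 and $z_r\mapsto-1/z_r$, and where $$\bar c_{\Pi F}=\bar\theta_0\cdots\bar\theta_6\,[d\bar z_l\,d\bar z_r\,|\,d\bar\theta_0\cdots d\bar\theta_6]\otimes\partial_{\bar z_l}\wedge\partial_{\bar z_r}.$$ Then: 1. $\mu$ is a globally defined integral form of type $(0,-2)$, and $D\mu=0$. 2. $\mu$ is nontrivial: $\mu\neq0$, and $\mu$ is not equal to $D\nu$ for any integral form $\nu$ of type $(0,\bullet)$. 3. $D$ maps $\Omega^{0\bullet}(\Pi F)$ to itself; the integral $\int_{\Pi F}a\,\mu$ converges for every $a\in\Omega^{0\bullet}(\Pi F)$ and is nonzero for some $a$ with $Da=0$. For every $n\ge0$ the linear functional $$\tau(a)=\mathrm{tr}\int_{\Pi F}a\,\mu\qquad\text{on}\qquad \Omega^{0\bullet}(\Pi F)\otimes \mathrm{Mat}_n$$ is a $D$-closed trace: $\tau(Da)=0$ for all $a$, and $\tau(ab)=(-1)^{|a||b|}\tau(ba)$ for all $a,b$ homogeneous with respect to parity. -/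

import Mathlib

open scoped ContDiff TensorProduct

noncomputable section

namespace SplitPiF

/-! ### Smooth functions on a coordinate patch of `X = P¹ × P¹` -/

/-- Points of a coordinate patch `ℂ²` of `P¹ × P¹`: `p 0 = z_l`, `p 1 = z_r`. -/
abbrev Pt : Type := Fin 2 → ℂ

/-- The algebra of complex-valued `C^∞` functions (in the real sense) on `ℂ²`. -/
def Sm : Subalgebra ℂ (Pt → ℂ) where
  carrier := {f | ContDiff ℝ ∞ f}
  mul_mem' {f g} hf hg := by
    have hf' : ContDiff ℝ ∞ f := hf
    have hg' : ContDiff ℝ ∞ g := hg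
    exact hf'.mul hg'
  add_mem' {f g} hf hg := by
    have hf' : ContDiff ℝ ∞ f := hf
    have hg' : ContDiff ℝ ∞ g := hg
    exact hf'.add hg'
  algebraMap_mem' r := by
    have h : ContDiff ℝ ∞ (fun _ : Pt => r) := contDiff_const
    exact h

theorem differentiable_of_Sm (f : Sm) : Differentiable ℝ f.1 := by
  have h : ContDiff ℝ ∞ f.1 := f.2
  exact h.differentiable (by simp)

/-- The function `∂f/∂z̄_i = (∂f/∂x_i + √-1 ∂f/∂y_i) / 2`. -/
def wirtinger (i : Fin 2) (f : Pt → ℂ) (p : Pt) : ℂ :=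
  (fderiv ℝ f p (Pi.single i 1) + Complex.I * fderiv ℝ f p (Pi.single i Complex.I)) / 2

theorem wirtinger_mem (i : Fin 2) (f : Sm) : wirtinger i f.1 ∈ Sm := by
  have hf : ContDiff ℝ ∞ f.1 := f.2
  have h : ContDiff ℝ ∞ (fderiv ℝ f.1) := hf.fderiv_right (by simp)
  have h1 : ∀ v : Pt, ContDiff ℝ ∞ (fun p => fderiv ℝ f.1 p v) :=
    fun v => h.clm_apply contDiff_const
  exact ((h1 _).add (contDiff_const.mul (h1 _))).div_const 2

/-- The operator `∂/∂z̄_i` on smooth functions. -/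
def dbarSm (i : Fin 2) : Sm →ₗ[ℂ] Sm where
  toFun f := ⟨wirtinger i f.1, wirtinger_mem i f⟩
  map_add' f g := by
    refine Subtype.ext (funext fun p => ?_)
    change wirtinger i (f.1 + g.1) p = wirtinger i f.1 p + wirtinger i g.1 p
    simp only [wirtinger, fderiv_add (differentiable_of_Sm f p) (differentiable_of_Sm g p),
      add_apply]
    ring
  map_smul' a f := by
    refine Subtype.ext (funext fun p => ?_)
    change wirtinger i (a • f.1) p = a * wirtinger i f.1 p
    simp only [wirtinger, fderiv_const_smul (differentiable_of_Sm f p) a, smul_apply,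
      smul_eq_mul]
    ring

/-! ### The local superalgebra

The odd fibre coordinates of `ΠF`, `F = T ⊗ O(1,0) ⊕ T* ⊗ O(0,1) ⊕ O(-1,-1)`, `dim T = 3`, are
numbered by `Fin 7`: `θ_0, θ_1, θ_2` belong to `T ⊗ O(1,0)`, `θ_3, θ_4, θ_5` (in the dual basis)
to `T* ⊗ O(0,1)` and `θ_6 = θ` to `Θ* = O(-1,-1)`. On the underlying real graded supermanifold
there are also the conjugate coordinates `θ̄_j`.

`Gr` is the free supercommutative algebra on
* odd generators `th j = θ_j`, `tb j = θ̄_j` (`j : Fin 7`), `xi i` (`i : Fin 2`),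
* even generators `eta j` (`j : Fin 7`).

It is used in two ways.
* For differential forms, `xi i = dz̄_i` and `eta j = dθ̄_j`.
* For polyvector fields, `xi i = z̄*_i` and `eta j = θ̄*_j` are the parity shifted vector fields
  `∂/∂z̄_i`, `∂/∂θ̄_j`, that is the generators of the super Grassmann algebra of the
  antiholomorphic tangent bundle. -/

/-- Labels of the odd generators `θ_j`, `θ̄_j`, `xi i`. -/
abbrev OddIdx : Type := Fin 7 ⊕ Fin 7 ⊕ Fin 2

abbrev Gr : Type := MvPolynomial (Fin 7) ℂ ⊗[ℂ] ExteriorAlgebra ℂ (OddIdx → ℂ)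

instance instRingGr : Ring Gr := Algebra.TensorProduct.instRing
instance instAlgebraGr : Algebra ℂ Gr := Algebra.TensorProduct.leftAlgebra
instance instAddCommGroupGr : AddCommGroup Gr := TensorProduct.addCommGroup
instance instHasDistribNegGr : HasDistribNeg Gr := NonUnitalNonAssocRing.toHasDistribNeg

def oddGen (s : OddIdx) : Gr := 1 ⊗ₜ[ℂ] ExteriorAlgebra.ι ℂ (Pi.single s (1 : ℂ))

def th (j : Fin 7) : Gr := oddGen (Sum.inl j)
def tb (j : Fin 7) : Gr := oddGen (Sum.inr (Sum.inl j))
def xi (i : Fin 2) : Gr := oddGen (Sum.inr (Sum.inr i))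
def eta (j : Fin 7) : Gr := MvPolynomial.X j ⊗ₜ[ℂ] 1

/-- The left derivative with respect to an odd generator (an odd derivation). -/
def dOdd (s : OddIdx) : Gr →ₗ[ℂ] Gr :=
  LinearMap.lTensor (MvPolynomial (Fin 7) ℂ)
    (CliffordAlgebra.contractLeft (Q := (0 : QuadraticForm ℂ (OddIdx → ℂ)))
      (LinearMap.proj s : Module.Dual ℂ (OddIdx → ℂ)))

def dTh (j : Fin 7) : Gr →ₗ[ℂ] Gr := dOdd (Sum.inl j)
def dTb (j : Fin 7) : Gr →ₗ[ℂ] Gr := dOdd (Sum.inr (Sum.inl j))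
def dXi (i : Fin 2) : Gr →ₗ[ℂ] Gr := dOdd (Sum.inr (Sum.inr i))

/-- The derivative with respect to the even generator `eta j`. -/
def dEta (j : Fin 7) : Gr →ₗ[ℂ] Gr :=
  LinearMap.rTensor (ExteriorAlgebra ℂ (OddIdx → ℂ)) (MvPolynomial.pderiv j).toLinearMap

/-- The parity operator: `1` on even elements and `-1` on odd elements. -/
def parityGr : Gr →ₐ[ℂ] Gr :=
  Algebra.TensorProduct.map (AlgHom.id ℂ (MvPolynomial (Fin 7) ℂ))
    (CliffordAlgebra.involute (Q := (0 : QuadraticForm ℂ (OddIdx → ℂ))))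

/-- `Gr`-valued smooth functions on a patch `ℂ²`: local forms, or local polyvector fields. -/
abbrev Loc : Type := Sm ⊗[ℂ] Gr

instance instRingLoc : Ring Loc := Algebra.TensorProduct.instRing
instance instAlgebraLoc : Algebra ℂ Loc := Algebra.TensorProduct.leftAlgebra
instance instAddCommGroupLoc : AddCommGroup Loc := TensorProduct.addCommGroup
instance instHasDistribNegLoc : HasDistribNeg Loc := NonUnitalNonAssocRing.toHasDistribNeg

/-- A constant element of `Gr` as a local section. -/
def const (x : Gr) : Loc := 1 ⊗ₜ[ℂ] x

/-- A `ℂ`-linear operator on `Gr`, extended linearly over smooth functions. -/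
def onGr (L : Gr →ₗ[ℂ] Gr) : Loc →ₗ[ℂ] Loc := LinearMap.lTensor Sm L

/-- `∂/∂z̄_i` acting on the coefficients. -/
def dZb (i : Fin 2) : Loc →ₗ[ℂ] Loc := LinearMap.rTensor Gr (dbarSm i)

/-- Evaluation of a local section at a point. -/
def ev (p : Pt) : Loc →ₐ[ℂ] Gr :=
  (Algebra.TensorProduct.lid ℂ Gr).toAlgHom.comp
    (Algebra.TensorProduct.map ((Pi.evalAlgHom ℂ (fun _ : Pt => ℂ) p).comp Sm.val)
      (AlgHom.id ℂ Gr))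

/-- The local Dolbeault operator `∂̄ = ∑ dz̄_i ∂/∂z̄_i + ∑ dθ̄_j ∂/∂θ̄_j`. -/
def dbar : Loc →ₗ[ℂ] Loc :=
  (∑ i : Fin 2, LinearMap.mulLeft ℂ (const (xi i)) ∘ₗ dZb i) +
    ∑ j : Fin 7, LinearMap.mulLeft ℂ (const (eta j)) ∘ₗ onGr (dTb j)

/-! ### Contraction of forms with polyvector fields -/

/-- The projection of the span of the odd generators to the span of the `θ_j`, `θ̄_j`. -/
def thPart : (OddIdx → ℂ) →ₗ[ℂ] (OddIdx → ℂ) :=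
  LinearMap.pi (Sum.elim (fun j => LinearMap.proj (Sum.inl j))
    (Sum.elim (fun j => LinearMap.proj (Sum.inr (Sum.inl j))) (fun _ => 0)))

/-- The pairing of the `dz̄_i` with the `z̄*_i`: `dz̄_i` is sent to the `i`-th coordinate. -/
def xiPart : (OddIdx → ℂ) →ₗ[ℂ] Module.Dual ℂ (OddIdx → ℂ) :=
  ∑ i : Fin 2, (LinearMap.proj (Sum.inr (Sum.inr i)) : Module.Dual ℂ (OddIdx → ℂ)).smulRight
    (LinearMap.proj (Sum.inr (Sum.inr i)) : Module.Dual ℂ (OddIdx → ℂ))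

/-- The action of an odd generator (extended linearly to the space they span) on polyvectors:
`θ_j`, `θ̄_j` multiply, `dz̄_i` acts as the contraction `∂/∂z̄*_i`. -/
def contrGen : (OddIdx → ℂ) →ₗ[ℂ] Module.End ℂ (ExteriorAlgebra ℂ (OddIdx → ℂ)) :=
  LinearMap.mul ℂ (ExteriorAlgebra ℂ (OddIdx → ℂ)) ∘ₗ ExteriorAlgebra.ι ℂ ∘ₗ thPart +
    CliffordAlgebra.contractLeft (Q := (0 : QuadraticForm ℂ (OddIdx → ℂ))) ∘ₗ xiPart

theorem contrGen_sq (v : OddIdx → ℂ) : contrGen v * contrGen v = 0 := by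
  have h0 : xiPart v (thPart v) = 0 := by
    simp [xiPart, thPart]
  have h1 : ∀ y : ExteriorAlgebra ℂ (OddIdx → ℂ),
      CliffordAlgebra.contractLeft (Q := (0 : QuadraticForm ℂ (OddIdx → ℂ))) (xiPart v)
        (ExteriorAlgebra.ι ℂ (thPart v) * y) = - (ExteriorAlgebra.ι ℂ (thPart v) *
          CliffordAlgebra.contractLeft (Q := (0 : QuadraticForm ℂ (OddIdx → ℂ)))
            (xiPart v) y) := by
    intro y
    have := CliffordAlgebra.contractLeft_ι_mul (Q := (0 : QuadraticForm ℂ (OddIdx → ℂ)))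
      (d := xiPart v) (thPart v) y
    rw [h0, zero_smul, zero_sub] at this
    exact this
  refine LinearMap.ext fun x => ?_
  have h2 : ∀ y : ExteriorAlgebra ℂ (OddIdx → ℂ), contrGen v y =
      ExteriorAlgebra.ι ℂ (thPart v) * y +
        CliffordAlgebra.contractLeft (Q := (0 : QuadraticForm ℂ (OddIdx → ℂ))) (xiPart v) y :=
    fun y => rfl
  rw [Module.End.mul_apply, h2, h2, map_add, h1, CliffordAlgebra.contractLeft_contractLeft,
    mul_add, ← mul_assoc, ExteriorAlgebra.ι_sq_zero]
  simp

/-- The odd part of the contraction, an algebra map into the operators. -/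
def contrExt : ExteriorAlgebra ℂ (OddIdx → ℂ) →ₐ[ℂ]
    Module.End ℂ (ExteriorAlgebra ℂ (OddIdx → ℂ)) :=
  ExteriorAlgebra.lift ℂ ⟨contrGen, contrGen_sq⟩

/-- The even part of the contraction: a polynomial in the `dθ̄_j` acts on polynomials in the
`θ̄*_j` as the constant coefficient differential operator with `dθ̄_j ↦ ∂/∂θ̄*_j`. -/
def contrPoly : MvPolynomial (Fin 7) ℂ →ₗ[ℂ] Module.End ℂ (MvPolynomial (Fin 7) ℂ) :=
  (MvPolynomial.basisMonomials (Fin 7) ℂ).constr ℂ fun m =>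
    (List.ofFn fun j : Fin 7 =>
      ((MvPolynomial.pderiv j).toLinearMap : Module.End ℂ (MvPolynomial (Fin 7) ℂ)) ^ m j).prod

/-- Contraction `contrGr a P` of a form `a` with a polyvector field `P`, at a point. -/
def contrGr : Gr →ₗ[ℂ] Gr →ₗ[ℂ] Gr := TensorProduct.map₂ contrPoly contrExt.toLinearMap

/-- Contraction of local forms with local polyvector fields. -/
def contr : Loc →ₗ[ℂ] Loc →ₗ[ℂ] Loc := TensorProduct.map₂ (LinearMap.mul ℂ Sm) contrGr

/-! ### Coordinate changes

`P¹` has the two coordinates `z` (label `false`, the large cell) and `z' = -1/z` (label `true`).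
A patch of `P¹ × P¹` is given by a label for each factor. For the frames `e`, `e' = z e` of `O(1)`
the fibre coordinate of the `j`-th summand of `F`, of degree `wt j i` along the `i`-th factor,
changes by `θ'_j = g_j θ_j`, `g_j = z_i ^ (- wt j i)`. -/

abbrev Chart : Type := Fin 2 → Bool

/-- The large cell. -/
def bigCell : Chart := fun _ => false

/-- The bidegrees of the line bundle summands of `F`. -/
def wt : Fin 7 → Fin 2 → ℤ :=
  ![![1, 0], ![1, 0], ![1, 0], ![0, 1], ![0, 1], ![0, 1], ![-1, -1]]

/-- The point with the `i`-th coordinate `z_i` replaced by `-1/z_i`. -/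
def flip (i : Fin 2) (p : Pt) : Pt := Function.update p i (-(p i)⁻¹)

/-- `g_j`. -/
def gFun (i : Fin 2) (p : Pt) (j : Fin 7) : ℂ := (p i) ^ (-(wt j i))

/-- `∂ log g_j / ∂z_i`. -/
def logDerivG (i : Fin 2) (p : Pt) (j : Fin 7) : ℂ := -(wt j i : ℂ) / p i

/-- `κ = dz'_i / dz_i`. -/
def kappa (i : Fin 2) (p : Pt) : ℂ := (p i ^ 2)⁻¹

/-- The algebra map rescaling the generators. -/
def rescale (s : OddIdx → ℂ) (t : Fin 7 → ℂ) : Gr →ₐ[ℂ] Gr :=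
  Algebra.TensorProduct.map
    (MvPolynomial.aeval fun j => MvPolynomial.C (t j) * MvPolynomial.X j)
    (ExteriorAlgebra.map (LinearMap.pi fun k => s k • LinearMap.proj k))

/-- `1 + xi_i ∑_j l_j θ̄_j ∂/∂eta_j`: as `xi_i ^ 2 = 0`, this is the substitution
`eta_j ↦ eta_j + l_j xi_i θ̄_j`. -/
def shearForm (i : Fin 2) (l : Fin 7 → ℂ) : Gr →ₗ[ℂ] Gr :=
  LinearMap.id + ∑ j : Fin 7, l j • (LinearMap.mulLeft ℂ (xi i * tb j) ∘ₗ dEta j)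

/-- `1 + ∑_j l_j θ̄_j eta_j ∂/∂xi_i`: as `∂/∂xi_i` squares to zero, this is the substitution
`xi_i ↦ xi_i + ∑_j l_j θ̄_j eta_j`. -/
def shearPoly (i : Fin 2) (l : Fin 7 → ℂ) : Gr →ₗ[ℂ] Gr :=
  LinearMap.id + ∑ j : Fin 7, l j • (LinearMap.mulLeft ℂ (tb j * eta j) ∘ₗ dXi i)

/-- Coordinate change of forms in the fibre over `p`, from the patch with coordinate `z'_i` to the
patch with coordinate `z_i`: it is the substitution
`θ'_j = g_j θ_j`, `θ̄'_j = ḡ_j θ̄_j`, `dz̄'_i = κ̄ dz̄_i`,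
`dθ̄'_j = ∂̄(ḡ_j θ̄_j) = ḡ_j dθ̄_j + (∂ḡ_j/∂z̄_i) dz̄_i θ̄_j`. -/
def formT (i : Fin 2) (p : Pt) : Gr →ₗ[ℂ] Gr :=
  shearForm i (fun j => star (logDerivG i p j)) ∘ₗ
    (rescale
      (Sum.elim (fun j => gFun i p j)
        (Sum.elim (fun j => star (gFun i p j))
          (fun k => if k = i then star (kappa i p) else 1)))
      (fun j => star (gFun i p j))).toLinearMap

/-- Coordinate change of polyvector fields in the fibre over `p`, dual to `formT` under
contraction: the substitution
`θ'_j = g_j θ_j`, `θ̄'_j = ḡ_j θ̄_j`, `θ̄*'_j = ḡ_j⁻¹ θ̄*_j`,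
`z̄*'_i = κ̄⁻¹ (z̄*_i + ∑_j (∂ log ḡ_j/∂z̄_i) θ̄_j θ̄*_j)`.
(As a vector field, `∂/∂z̄'_i = κ̄⁻¹ (∂/∂z̄_i - ∑_j (∂ log ḡ_j/∂z̄_i) θ̄_j ∂/∂θ̄_j)`; the parity
shift changes the sign of the terms with the odd coefficient `θ̄_j`.) -/
def polyT (i : Fin 2) (p : Pt) : Gr →ₗ[ℂ] Gr :=
  shearPoly i (fun j => star (logDerivG i p j)) ∘ₗ
    (rescale
      (Sum.elim (fun j => gFun i p j)
        (Sum.elim (fun j => star (gFun i p j))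
          (fun k => if k = i then (star (kappa i p))⁻¹ else 1)))
      (fun j => (star (gFun i p j))⁻¹)).toLinearMap

/-- The holomorphic Berezinian of the coordinate change: `[dz' | dθ'] = berC [dz | dθ]`. -/
def berC (i : Fin 2) (p : Pt) : ℂ := kappa i p * ∏ j : Fin 7, (gFun i p j)⁻¹

/-- A family of local sections, one in each patch, is glued by the coordinate change `T` and the
transition factor `χ` on the intersections of patches that differ in one label. (These relations
imply those on the other intersections, by composition.) -/
def Glued (T : Fin 2 → Pt → Gr →ₗ[ℂ] Gr) (χ : Fin 2 → Pt → ℂ) (σ : Chart → Loc) : Prop :=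
  ∀ (c : Chart) (i : Fin 2) (p : Pt), c i = false → p i ≠ 0 →
    ev p (σ c) = χ i p • T i p (ev (flip i p) (σ (Function.update c i true)))

/-! ### The Dolbeault algebra of `ΠF` -/

theorem oddGen_anticomm (s t : OddIdx) : oddGen s * oddGen t = -(oddGen t * oddGen s) := by
  have h := ExteriorAlgebra.ι_add_mul_swap (R := ℂ) (Pi.single s (1 : ℂ) : OddIdx → ℂ)
    (Pi.single t (1 : ℂ))
  simp only [oddGen, Algebra.TensorProduct.tmul_mul_tmul, one_mul]
  rw [eq_neg_of_add_eq_zero_left h, TensorProduct.tmul_neg]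

theorem oddGen_sq (s : OddIdx) : oddGen s * oddGen s = 0 := by
  simp [oddGen, Algebra.TensorProduct.tmul_mul_tmul]

theorem ι_mul_ι_comm (u v : OddIdx → ℂ) (x : ExteriorAlgebra ℂ (OddIdx → ℂ)) :
    x * (ExteriorAlgebra.ι ℂ u * ExteriorAlgebra.ι ℂ v) =
      ExteriorAlgebra.ι ℂ u * ExteriorAlgebra.ι ℂ v * x := by
  induction x using ExteriorAlgebra.induction with
  | algebraMap r => exact Algebra.commutes r _
  | ι w =>
    have h1 := eq_neg_of_add_eq_zero_left (ExteriorAlgebra.ι_add_mul_swap (R := ℂ) w u)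
    have h2 := eq_neg_of_add_eq_zero_left (ExteriorAlgebra.ι_add_mul_swap (R := ℂ) w v)
    rw [← mul_assoc, h1, neg_mul, mul_assoc, h2, mul_neg, neg_neg, mul_assoc]
  | mul a b ha hb => rw [mul_assoc, hb, ← mul_assoc, ha, mul_assoc]
  | add a b ha hb => rw [add_mul, mul_add, ha, hb]

theorem oddGen_mul_comm (s t : OddIdx) (x : Gr) :
    x * (oddGen s * oddGen t) = oddGen s * oddGen t * x := by
  induction x using TensorProduct.induction_on with
  | zero => simp
  | tmul a y =>
    simp only [oddGen, Algebra.TensorProduct.tmul_mul_tmul, one_mul, mul_one, ι_mul_ι_comm]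
  | add a b ha hb => rw [add_mul, mul_add, ha, hb]

theorem dEta_mul (j : Fin 7) (x y : Gr) : dEta j (x * y) = dEta j x * y + x * dEta j y := by
  induction x using TensorProduct.induction_on with
  | zero => simp
  | add a b ha hb => rw [add_mul, map_add, map_add, ha, hb]; noncomm_ring
  | tmul a u =>
    induction y using TensorProduct.induction_on with
    | zero => simp
    | add c d hc hd => rw [mul_add, map_add, map_add, hc, hd]; noncomm_ring
    | tmul c v =>
      simp only [dEta, LinearMap.rTensor_tmul, Algebra.TensorProduct.tmul_mul_tmul,
        Derivation.coeFn_coe, Derivation.leibniz, smul_eq_mul, TensorProduct.add_tmul]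
      rw [mul_comm c, add_comm]

theorem shearForm_apply (i : Fin 2) (l : Fin 7 → ℂ) (x : Gr) :
    shearForm i l x = x + ∑ j : Fin 7, l j • (xi i * tb j * dEta j x) := by
  simp [shearForm, LinearMap.sum_apply, mul_assoc]

theorem shearForm_mul (i : Fin 2) (l : Fin 7 → ℂ) (x y : Gr) :
    shearForm i l (x * y) = shearForm i l x * shearForm i l y := by
  have hc : ∀ (j : Fin 7) (u : Gr), u * (xi i * tb j) = xi i * tb j * u :=
    fun j u => oddGen_mul_comm _ _ u
  have hz : ∀ j k : Fin 7, xi i * tb j * (xi i * tb k) = 0 := by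
    intro j k
    have h : tb j * xi i = -(xi i * tb j) := oddGen_anticomm _ _
    have h2 : xi i * xi i = 0 := oddGen_sq _
    calc xi i * tb j * (xi i * tb k) = xi i * (tb j * xi i) * tb k := by noncomm_ring
      _ = -(xi i * xi i * tb j * tb k) := by
        rw [h, mul_neg, neg_mul]; simp only [mul_assoc]
      _ = 0 := by rw [h2]; simp
  have hzz : (∑ j : Fin 7, l j • (xi i * tb j * dEta j x)) *
      (∑ k : Fin 7, l k • (xi i * tb k * dEta k y)) = 0 := by
    rw [Finset.sum_mul_sum]
    refine Finset.sum_eq_zero fun j _ => Finset.sum_eq_zero fun k _ => ?_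
    have : xi i * tb j * dEta j x * (xi i * tb k * dEta k y) = 0 := by
      rw [mul_assoc, ← mul_assoc (dEta j x), hc, mul_assoc (xi i * tb k), ← mul_assoc, hz, zero_mul]
    rw [smul_mul_smul_comm, this, smul_zero]
  have hsum : ∑ j : Fin 7, l j • (xi i * tb j * dEta j (x * y)) =
      (∑ j : Fin 7, l j • (xi i * tb j * dEta j x)) * y +
        x * ∑ j : Fin 7, l j • (xi i * tb j * dEta j y) := by
    rw [Finset.sum_mul, Finset.mul_sum, ← Finset.sum_add_distrib]
    refine Finset.sum_congr rfl fun j _ => ?_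
    rw [dEta_mul, smul_mul_assoc, mul_smul_comm, ← smul_add, mul_add, ← mul_assoc, ← mul_assoc x,
      hc, ← mul_assoc]
  rw [shearForm_apply, shearForm_apply, shearForm_apply, hsum, add_mul, mul_add, mul_add, hzz]
  abel

theorem formT_mul (i : Fin 2) (p : Pt) (x y : Gr) :
    formT i p (x * y) = formT i p x * formT i p y := by
  simp only [formT, LinearMap.comp_apply, AlgHom.toLinearMap_apply, map_mul, shearForm_mul]

theorem formT_one (i : Fin 2) (p : Pt) : formT i p 1 = 1 := by
  simp only [formT, LinearMap.comp_apply, AlgHom.toLinearMap_apply, map_one, shearForm_apply]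
  have h : ∀ j, dEta j (1 : Gr) = 0 := by
    intro j
    simp [dEta, Algebra.TensorProduct.one_def]
  simp [h]

/-- The Dolbeault algebra `Ω^{0•}(ΠF)` (the sum of all degrees) of `ΠF`, considered as a graded
real supermanifold: families of local forms in the variables `z, z̄, θ, θ̄, dz̄, dθ̄` that agree
under coordinate changes. -/
def Dolb : Subalgebra ℂ (Chart → Loc) where
  carrier := {σ | Glued formT (fun _ _ => 1) σ}
  mul_mem' {a b} ha hb c i p hc hp := by
    have h1 := ha c i p hc hp
    have h2 := hb c i p hc hp
    simp only [one_smul] at h1 h2 ⊢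
    simp only [Pi.mul_apply, map_mul, formT_mul, h1, h2]
  add_mem' {a b} ha hb c i p hc hp := by
    have h1 := ha c i p hc hp
    have h2 := hb c i p hc hp
    simp only [one_smul] at h1 h2 ⊢
    simp only [Pi.add_apply, map_add, h1, h2]
  algebraMap_mem' r c i p _ _ := by
    simp only [one_smul, Pi.algebraMap_apply, AlgHom.commutes]
    rw [Algebra.algebraMap_eq_smul_one, map_smul, formT_one]

instance instRingDolb : Ring Dolb := Dolb.toRing
instance instAlgebraDolb : Algebra ℂ Dolb := Dolb.algebra
instance instModuleDolb : Module ℂ Dolb := Algebra.toModule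

/-- Parity of a family of local forms: even if `k` is even, odd if `k` is odd. -/
def HasParity (k : ℕ) (σ : Chart → Loc) : Prop :=
  ∀ c, onGr parityGr.toLinearMap (σ c) = (-1 : ℂ) ^ k • σ c

/-! ### The fundamental class and the deformed differential -/

/-- Sections of `Ω^{0•}(ΠF)` with values in `O(d 0, d 1)`, in the frames `e, e' = z e`. -/
def IsTwisted (d : Fin 2 → ℤ) (σ : Chart → Loc) : Prop :=
  Glued formT (fun i p => (p i) ^ (d i)) σ

/-- `Ω^{0,2}(X, O(-2,-2))`. -/
def IsTopForm (φ : Chart → Loc) : Prop :=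
  IsTwisted (fun _ => -2) φ ∧ ∀ c, ∃ f : Sm, φ c = f ⊗ₜ[ℂ] (xi 0 * xi 1)

/-- `Ω^{0,1}(X, O(-2,-2))`. -/
def IsOneForm (ψ : Chart → Loc) : Prop :=
  IsTwisted (fun _ => -2) ψ ∧ ∀ c, ∃ f : Fin 2 → Sm, ψ c = ∑ k : Fin 2, f k ⊗ₜ[ℂ] xi k

/-- `Ω^{0,1}(X, Λ²H* ⊗ Θ*)` with `H = T ⊗ O(1,0) ⊕ T* ⊗ O(0,1)` and `Θ* = O(-1,-1)`; the fibre
coordinates of `H` are `θ_0, …, θ_5`. -/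
def IsGaugeForm (B : Chart → Loc) : Prop :=
  IsTwisted (fun _ => -1) B ∧ ∀ c, ∃ b : Fin 6 → Fin 6 → Fin 2 → Sm, B c =
    ∑ i : Fin 6, ∑ j : Fin 6, ∑ k : Fin 2, b i j k ⊗ₜ[ℂ] (th i.castSucc * th j.castSucc * xi k)

/-- The image of the identity of `T` in `T ⊗ T* ⊗ O(-1,-1) ⊆ Λ²H*`. -/
def idT : Gr := th 0 * th 3 + th 1 * th 4 + th 2 * th 5

/-- `W` represents the fundamental class: `W ∈ Ω^{0,2}(X, Λ²H* ⊗ Θ*)` is Dolbeault cohomologous,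
with coefficients in `Λ²H* ⊗ Θ*`, to `id_T ⊗ φ` where `φ ∈ Ω^{0,2}(X, O(-2,-2))` has a nonzero
class in the (one-dimensional) space `H²(X, O(-2,-2))`. -/
def RepresentsFundamentalClass (W : Chart → Loc) : Prop :=
  ∃ φ B : Chart → Loc, IsTopForm φ ∧ (¬ ∃ ψ, IsOneForm ψ ∧ ∀ c, dbar (ψ c) = φ c) ∧
    IsGaugeForm B ∧ ∀ c, W c = const idT * φ c + dbar (B c)

/-- The deformed differential `D = ∂̄ + α` on forms, patch by patch, with `α = W ∂/∂θ`. -/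
def dForm (W : Chart → Loc) : (Chart → Loc) →ₗ[ℂ] (Chart → Loc) :=
  LinearMap.pi fun c =>
    (dbar + LinearMap.mulLeft ℂ (W c) ∘ₗ onGr (dTh 6)) ∘ₗ LinearMap.proj c

/-! ### Integral forms -/

/-- The space of integral forms of type `(0,•)` on `ΠF` as a graded real supermanifold: global
sections of `Ber_ℂ ⊗ conj(Ber_ℂ) ⊗ Λ(antiholomorphic tangent bundle)`. In each patch a section is
written as a polyvector field times the coordinate Berezinian `[dz dz̄ | dθ dθ̄]`. -/
def intForms : Submodule ℂ (Chart → Loc) where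
  carrier := {σ | Glued polyT (fun i p => berC i p * star (berC i p)) σ}
  zero_mem' c i p _ _ := by simp
  add_mem' {a b} ha hb c i p hc hp := by
    have h1 := ha c i p hc hp
    have h2 := hb c i p hc hp
    simp only [Pi.add_apply, map_add, h1, h2, smul_add]
  smul_mem' r a ha c i p hc hp := by
    have h1 := ha c i p hc hp
    simp only [Pi.smul_apply, map_smul, h1]
    rw [smul_comm]

/-- The operator that multiplies a polyvector field of degree `k` by `k`. -/
def euler : Gr →ₗ[ℂ] Gr :=
  (∑ i : Fin 2, LinearMap.mulLeft ℂ (xi i) ∘ₗ dXi i) +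
    ∑ j : Fin 7, LinearMap.mulLeft ℂ (eta j) ∘ₗ dEta j

/-- `σ` is an integral form of type `(0,-k)`: the polyvector field has degree `k`. -/
def IsIntForm (k : ℕ) (σ : Chart → Loc) : Prop :=
  σ ∈ intForms ∧ ∀ c, onGr euler (σ c) = (k : ℂ) • σ c

/-- The operator `∂̄` on integral forms in a patch, the divergence
`∑ ∂/∂z̄*_i ∂/∂z̄_i + ∑ ∂/∂θ̄*_j ∂/∂θ̄_j`. (It is `dbar` with `dz̄_i`, `dθ̄_j` acting by
contraction, so that integral forms are a differential module over forms.) -/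
def dbarInt : Loc →ₗ[ℂ] Loc :=
  (∑ i : Fin 2, onGr (dXi i) ∘ₗ dZb i) + ∑ j : Fin 7, onGr (dEta j) ∘ₗ onGr (dTb j)

/-- The deformed differential `D = ∂̄ + α` on integral forms, patch by patch: `α = W ∂/∂θ` acts by
the Lie derivative `P ↦ ∂/∂θ (W P)`, where the form `W` acts by contraction. -/
def dInt (W : Chart → Loc) : (Chart → Loc) →ₗ[ℂ] (Chart → Loc) :=
  LinearMap.pi fun c => (dbarInt + onGr (dTh 6) ∘ₗ contr (W c)) ∘ₗ LinearMap.proj c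

/-- `vol_{ΠF} = [dz_l dz_r | dθ_0 … dθ_6]`, the section of `Ber_ℂ` equal to the holomorphic
coordinate Berezinian in each patch. -/
def volF : Chart → Loc := fun _ => 1

/-- `c̄_{ΠF} = θ̄_0 … θ̄_6 dθ̄_0 ⋯ dθ̄_6`, the section of `conj(Ber_ℂ) ⊗ Λ²` given by
`θ̄_0 … θ̄_6 [dz̄_l dz̄_r | dθ̄_0 … dθ̄_6] ⊗ (∂/∂z̄_l ∧ ∂/∂z̄_r)`. -/
def cBar : Chart → Loc := fun _ => const ((List.ofFn tb).prod * xi 0 * xi 1)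

/-- `μ = vol_{ΠF} ⊗ c̄_{ΠF}`. -/
def mu : Chart → Loc := volF * cBar

/-! ### Integration -/

/-- The component without generators. -/
def constPart : Gr →ₐ[ℂ] ℂ :=
  (Algebra.TensorProduct.lid ℂ ℂ).toAlgHom.comp
    (Algebra.TensorProduct.map (MvPolynomial.aeval fun _ => (0 : ℂ))
      ExteriorAlgebra.algebraMapInv)

/-- The Berezin integral over all `θ_j`, `θ̄_j` of the component of polyvector degree zero. -/
def berezin : Gr →ₗ[ℂ] ℂ :=
  constPart.toLinearMap ∘ₗ
    ((List.ofFn fun j => (dTh j : Module.End ℂ Gr)).prod *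
      (List.ofFn fun j => (dTb j : Module.End ℂ Gr)).prod)

/-- The density on the large cell obtained from `⟨a, m⟩`, a section of the Berezinian line bundle,
by integration along the odd fibres. -/
def integrand (a m : Chart → Loc) (p : Pt) : ℂ :=
  berezin (contrGr (ev p (a bigCell)) (ev p (m bigCell)))

/-- `∫_{ΠF} ⟨a, m⟩` for a form `a` and an integral form `m`. The complement of the large cell has
measure zero, and `dz_l dz_r dz̄_l dz̄_r = 4 dx_l dy_l dx_r dy_r`. -/
def superInt (a m : Chart → Loc) : ℂ := 4 * ∫ p : Pt, integrand a m p

end SplitPiF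

end

/-!
Everything is reduced to statements about the fibre algebra `Gr` at one point. A local section is
determined by its values `ev p` (`loc_ext`), and `Gr` is handled by induction on monomials
(`gr_induction`): odd derivatives, substitutions and contractions are known once they are known on
a generator times an element.

*The functional `∫ a μ`.* Contraction with `θ̄_0 … θ̄_6 z̄*_0 z̄*_1` followed by the Berezin
integral is a functional `topCoeff` on `Gr` that kills all terms containing some `θ̄_j` or `dθ̄_j`
and reads off, up to sign, the coefficient of `θ_0 … θ_6 dz̄_0 dz̄_1`. Because the Berezinian of
`ΠF` is trivial, that is `K_X ⊗ det F = O` (`prod_gFun`), this coefficient is a section of the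
density bundle of `X` (`topCoeff_formT`): it changes by `|z_i|⁻⁴`. Since `X` is compact, a scalar
family with such transition factors decays on the large cell like `∏ (1 + |z_i|)⁻⁴`
(`exists_decay`), which is integrable.

*`D` acts on `Ω^{0•}(ΠF)`.* The point is that `∂̄` commutes with coordinate changes (`Glued.dbar`).
Derivatives of `Gr`-valued functions are tested against linear functionals (`HasDbar`), so that the
Leibniz rule is available on generators and the claim follows by the same induction
(`dbar_formT`). It applies to sections of holomorphic line bundles as well, hence to `W`.

*`τ` is closed.* `α` does not contribute, as `W` is free of `θ_6` and `∂/∂θ_6` removes it. The rest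
is `∑ ∂u_k/∂z̄_k`, where `u_k` is the coefficient of `θ_0 … θ_6 dz̄_l`, `l ≠ k`. The function `u_k`
decays only like `|z_k|⁻²` in the direction of `z_k`, but cutting off at radius `R` costs a factor
`1/R`, and dominated convergence gives `∫ ∂u_k/∂z̄_k = 0` (`integral_wirtinger_eq_zero`).
The trace property is the supercommutativity of `Gr` (`mul_supercomm`).

*Nontriviality.* The form `∏ (1 + |z_i|²)⁻² θ_0 … θ_6 dz̄_0 dz̄_1`, given by the same formula in all
patches, is closed and has nonzero integral. That `μ` is not exact is seen locally: no integral form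
`D ν` has a component along `θ̄_0 … θ̄_6 z̄*_0 z̄*_1` (`oddDer_dInt`).
-/

noncomputable section

namespace SplitPiF

/-! ### The algebra `Gr`: induction on generators, derivatives, substitutions -/

theorem dOdd_one (s : OddIdx) : dOdd s (1 : Gr) = 0 := by
  simp [dOdd, Algebra.TensorProduct.one_def]

theorem dEta_one (j : Fin 7) : dEta j (1 : Gr) = 0 := by
  simp [dEta, Algebra.TensorProduct.one_def]

theorem dOdd_oddGen_mul (s t : OddIdx) (x : Gr) :
    dOdd s (oddGen t * x) = (if s = t then x else 0) - oddGen t * dOdd s x := by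
  induction x using TensorProduct.induction_on with
  | zero => simp
  | add a b ha hb =>
    rw [mul_add, map_add, map_add, ha, hb, mul_add]
    split_ifs <;> abel
  | tmul a u =>
    simp only [dOdd, oddGen, LinearMap.lTensor_tmul, Algebra.TensorProduct.tmul_mul_tmul, one_mul]
    have := CliffordAlgebra.contractLeft_ι_mul (Q := (0 : QuadraticForm ℂ (OddIdx → ℂ)))
      (d := (LinearMap.proj s : Module.Dual ℂ (OddIdx → ℂ))) (Pi.single t (1 : ℂ)) u
    erw [this]
    rw [TensorProduct.tmul_sub]
    by_cases h : s = t
    · subst h; simp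
    · simp [h]

theorem dOdd_eta_mul (s : OddIdx) (j : Fin 7) (x : Gr) :
    dOdd s (eta j * x) = eta j * dOdd s x := by
  induction x using TensorProduct.induction_on with
  | zero => simp
  | add a b ha hb => rw [mul_add, map_add, map_add, ha, hb, mul_add]
  | tmul a u => simp [dOdd, eta, Algebra.TensorProduct.tmul_mul_tmul]

theorem dEta_oddGen (j : Fin 7) (s : OddIdx) : dEta j (oddGen s) = 0 := by
  simp [dEta, oddGen]

theorem dEta_oddGen_mul (j : Fin 7) (s : OddIdx) (x : Gr) :
    dEta j (oddGen s * x) = oddGen s * dEta j x := by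
  rw [dEta_mul, dEta_oddGen, zero_mul, zero_add]

theorem dEta_eta (j k : Fin 7) : dEta j (eta k) = if j = k then 1 else 0 := by
  simp only [dEta, eta, LinearMap.rTensor_tmul, Derivation.coeFn_coe]
  by_cases h : j = k
  · subst h; simp [Algebra.TensorProduct.one_def]
  · simp [h, MvPolynomial.pderiv_X_of_ne (Ne.symm h)]

theorem eta_comm (j : Fin 7) (x : Gr) : x * eta j = eta j * x := by
  induction x using TensorProduct.induction_on with
  | zero => simp
  | add a b ha hb => rw [add_mul, mul_add, ha, hb]
  | tmul a u => simp [eta, Algebra.TensorProduct.tmul_mul_tmul, mul_comm]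

/-- Induction on the length of monomials: a property of elements of `Gr` that is linear and is
preserved by left multiplication with each generator holds for all elements once it holds
for `1`. -/
@[elab_as_elim]
theorem gr_induction {P : Gr → Prop} (x : Gr) (one : P 1)
    (add : ∀ x y, P x → P y → P (x + y)) (smul : ∀ (r : ℂ) x, P x → P (r • x))
    (odd : ∀ s x, P x → P (oddGen s * x)) (even : ∀ j x, P x → P (eta j * x)) : P x := by
  have hodd : ∀ (v : OddIdx → ℂ) (x : Gr), P x →
      P ((1 ⊗ₜ[ℂ] ExteriorAlgebra.ι ℂ v : Gr) * x) := by
    intro v x hx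
    have hv : (1 ⊗ₜ[ℂ] ExteriorAlgebra.ι ℂ v : Gr) = ∑ s, v s • oddGen s := by
      have : v = ∑ s, v s • (Pi.single s (1 : ℂ) : OddIdx → ℂ) := by
        ext t; simp [Finset.sum_apply, Pi.single_apply]
      conv_lhs => rw [this]
      rw [map_sum, TensorProduct.tmul_sum]
      refine Finset.sum_congr rfl fun s _ => ?_
      rw [map_smul, TensorProduct.tmul_smul]; rfl
    rw [hv, Finset.sum_mul]
    refine Finset.sum_induction _ P add ?_ fun s _ => ?_
    · simpa using smul 0 1 one
    · rw [smul_mul_assoc]; exact smul _ _ (odd s x hx)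
  have hext : ∀ (u : ExteriorAlgebra ℂ (OddIdx → ℂ)) (x : Gr), P x →
      P ((1 ⊗ₜ[ℂ] u : Gr) * x) := by
    intro u
    induction u using ExteriorAlgebra.induction with
    | algebraMap r =>
      intro x hx
      have : (1 ⊗ₜ[ℂ] algebraMap ℂ _ r : Gr) = r • 1 := by
        rw [Algebra.algebraMap_eq_smul_one, TensorProduct.tmul_smul]; rfl
      rw [this, smul_mul_assoc, one_mul]
      exact smul _ _ hx
    | ι v => exact hodd v
    | mul a b ha hb =>
      intro x hx
      have : (1 ⊗ₜ[ℂ] (a * b) : Gr) = (1 ⊗ₜ[ℂ] a : Gr) * (1 ⊗ₜ[ℂ] b : Gr) := by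
        rw [Algebra.TensorProduct.tmul_mul_tmul, one_mul]
      rw [this, mul_assoc]
      exact ha _ (hb _ hx)
    | add a b ha hb =>
      intro x hx
      rw [TensorProduct.tmul_add, add_mul]
      exact add _ _ (ha _ hx) (hb _ hx)
  have hpoly : ∀ (f : MvPolynomial (Fin 7) ℂ) (x : Gr), P x → P ((f ⊗ₜ[ℂ] 1 : Gr) * x) := by
    intro f
    induction f using MvPolynomial.induction_on with
    | C r =>
      intro x hx
      have : (MvPolynomial.C r ⊗ₜ[ℂ] 1 : Gr) = r • 1 := by
        rw [← MvPolynomial.algebraMap_eq, Algebra.algebraMap_eq_smul_one,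
          ← TensorProduct.smul_tmul']; rfl
      rw [this, smul_mul_assoc, one_mul]
      exact smul _ _ hx
    | add a b ha hb =>
      intro x hx
      rw [TensorProduct.add_tmul, add_mul]
      exact add _ _ (ha _ hx) (hb _ hx)
    | mul_X a j ha =>
      intro x hx
      have : ((a * MvPolynomial.X j) ⊗ₜ[ℂ] 1 : Gr) = (a ⊗ₜ[ℂ] 1 : Gr) * eta j := by
        rw [eta, Algebra.TensorProduct.tmul_mul_tmul, one_mul]
      rw [this, mul_assoc]
      exact ha _ (even _ _ hx)
  induction x using TensorProduct.induction_on with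
  | zero => simpa using smul 0 1 one
  | add a b ha hb => exact add _ _ ha hb
  | tmul f u =>
    have : (f ⊗ₜ[ℂ] u : Gr) = (f ⊗ₜ[ℂ] 1 : Gr) * ((1 ⊗ₜ[ℂ] u : Gr) * 1) := by
      rw [mul_one, Algebra.TensorProduct.tmul_mul_tmul, one_mul, mul_one]
    rw [this]
    exact hpoly _ _ (hext _ _ one)

theorem dOdd_anticomm (s t : OddIdx) (x : Gr) : dOdd s (dOdd t x) = -dOdd t (dOdd s x) := by
  induction x using TensorProduct.induction_on with
  | zero => simp
  | add a b ha hb => simp only [map_add, ha, hb, neg_add]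
  | tmul a u =>
    simp only [dOdd, LinearMap.lTensor_tmul]
    rw [CliffordAlgebra.contractLeft_comm, TensorProduct.tmul_neg]

theorem dOdd_dOdd_self (s : OddIdx) (x : Gr) : dOdd s (dOdd s x) = 0 := by
  induction x using TensorProduct.induction_on with
  | zero => simp
  | add a b ha hb => simp only [map_add, ha, hb, add_zero]
  | tmul a u =>
    simp only [dOdd, LinearMap.lTensor_tmul]
    rw [CliffordAlgebra.contractLeft_contractLeft, TensorProduct.tmul_zero]

theorem dEta_dOdd (j : Fin 7) (s : OddIdx) (x : Gr) :
    dEta j (dOdd s x) = dOdd s (dEta j x) := by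
  induction x using TensorProduct.induction_on with
  | zero => simp
  | add a b ha hb => simp only [map_add, ha, hb]
  | tmul a u => simp [dEta, dOdd]

theorem oddGen_mul_oddGen_mul (s t : OddIdx) (x : Gr) :
    oddGen s * (oddGen t * x) = -(oddGen t * (oddGen s * x)) := by
  rw [← mul_assoc, oddGen_anticomm, neg_mul, mul_assoc]

theorem oddGen_mul_self_mul (s : OddIdx) (x : Gr) : oddGen s * (oddGen s * x) = 0 := by
  rw [← mul_assoc, oddGen_sq, zero_mul]

theorem parityGr_oddGen (s : OddIdx) : parityGr (oddGen s) = -oddGen s := by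
  have : CliffordAlgebra.involute (Q := (0 : QuadraticForm ℂ (OddIdx → ℂ)))
    (ExteriorAlgebra.ι ℂ (Pi.single s (1 : ℂ))) = -ExteriorAlgebra.ι ℂ (Pi.single s (1 : ℂ)) :=
    CliffordAlgebra.involute_ι _
  simp only [parityGr, oddGen, Algebra.TensorProduct.map_tmul]
  erw [this]
  rw [TensorProduct.tmul_neg, map_one]

theorem parityGr_eta (j : Fin 7) : parityGr (eta j) = eta j := by
  simp [parityGr, eta]

theorem oddGen_mul_eq_parityGr_mul (s : OddIdx) (x : Gr) :
    oddGen s * x = parityGr x * oddGen s := by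
  induction x using gr_induction with
  | one => simp
  | add x y hx hy => rw [mul_add, map_add, add_mul, hx, hy]
  | smul r x hx => rw [mul_smul_comm, map_smul, smul_mul_assoc, hx]
  | odd t x hx =>
    rw [oddGen_mul_oddGen_mul, hx, map_mul, parityGr_oddGen, neg_mul, neg_mul, mul_assoc]
  | even j x hx =>
    rw [map_mul, parityGr_eta, mul_assoc, ← hx, ← mul_assoc, eta_comm, mul_assoc]

theorem mul_comm_of_parityGr_eq {y : Gr} (hy : parityGr y = y) (x : Gr) : x * y = y * x := by
  induction x using gr_induction with
  | one => simp
  | add x z hx hz => rw [mul_add, add_mul, hx, hz]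
  | smul r x hx => rw [mul_smul_comm, smul_mul_assoc, hx]
  | odd s x hx => rw [mul_assoc, hx, ← mul_assoc, oddGen_mul_eq_parityGr_mul, hy, mul_assoc]
  | even j x hx => rw [mul_assoc, hx, ← mul_assoc, ← eta_comm, mul_assoc]

theorem mul_eq_mul_parityGr_of_odd {y : Gr} (hy : parityGr y = -y) (x : Gr) :
    x * y = y * parityGr x := by
  induction x using gr_induction with
  | one => simp
  | add x z hx hz => rw [map_add, mul_add, add_mul, hx, hz]
  | smul r x hx => rw [map_smul, mul_smul_comm, smul_mul_assoc, hx]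
  | odd s x hx =>
    rw [mul_assoc, hx, ← mul_assoc, oddGen_mul_eq_parityGr_mul, hy, map_mul, parityGr_oddGen,
      neg_mul, neg_mul, mul_assoc, ← mul_neg, neg_mul]
  | even j x hx =>
    rw [mul_assoc, hx, ← mul_assoc, ← eta_comm, map_mul, parityGr_eta, mul_assoc]

/-- `Gr` is supercommutative. -/
theorem mul_supercomm {k l : ℕ} {x y : Gr} (hx : parityGr x = (-1 : ℂ) ^ k • x)
    (hy : parityGr y = (-1 : ℂ) ^ l • y) : x * y = (-1 : ℂ) ^ (k * l) • (y * x) := by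
  rcases Nat.even_or_odd l with hl | hl
  · rw [hl.neg_one_pow, one_smul] at hy
    rw [(hl.mul_left k).neg_one_pow, one_smul, mul_comm_of_parityGr_eq hy]
  · rw [hl.neg_one_pow, neg_one_smul] at hy
    rw [mul_eq_mul_parityGr_of_odd hy, hx, mul_smul_comm, mul_comm k, pow_mul, hl.neg_one_pow]

theorem rescale_oddGen (s : OddIdx → ℂ) (t : Fin 7 → ℂ) (k : OddIdx) :
    rescale s t (oddGen k) = s k • oddGen k := by
  simp only [rescale, oddGen, Algebra.TensorProduct.map_tmul, map_one,
    ExteriorAlgebra.map_apply_ι]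
  rw [← TensorProduct.tmul_smul, ← map_smul]
  congr 2
  ext j
  by_cases h : j = k
  · subst h; simp
  · simp [Pi.single_eq_of_ne h]

theorem rescale_eta (s : OddIdx → ℂ) (t : Fin 7 → ℂ) (j : Fin 7) :
    rescale s t (eta j) = t j • eta j := by
  simp only [rescale, eta, Algebra.TensorProduct.map_tmul, map_one, MvPolynomial.aeval_X]
  rw [← MvPolynomial.smul_eq_C_mul, TensorProduct.smul_tmul']

theorem dOdd_rescale (s : OddIdx → ℂ) (t : Fin 7 → ℂ) (k : OddIdx) (x : Gr) :
    dOdd k (rescale s t x) = s k • rescale s t (dOdd k x) := by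
  induction x using gr_induction with
  | one => simp [dOdd_one]
  | add x y hx hy => simp only [map_add, hx, hy, smul_add]
  | smul r x hx => rw [map_smul, map_smul, map_smul, map_smul, hx, smul_comm]
  | odd j x hx =>
    rw [map_mul, rescale_oddGen, smul_mul_assoc, map_smul, dOdd_oddGen_mul, dOdd_oddGen_mul, hx,
      map_sub, map_mul, rescale_oddGen, smul_mul_assoc, smul_sub, smul_sub, mul_smul_comm,
      smul_comm (s j)]
    congr 1
    by_cases h : k = j
    · subst h; simp
    · simp [h]
  | even j x hx =>
    rw [map_mul, rescale_eta, smul_mul_assoc, map_smul, dOdd_eta_mul, dOdd_eta_mul, hx,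
      map_mul, rescale_eta, smul_mul_assoc, mul_smul_comm, smul_comm]

theorem constPart_oddGen (s : OddIdx) : constPart (oddGen s) = 0 := by
  simp only [constPart, oddGen, AlgHom.comp_apply, Algebra.TensorProduct.map_tmul]
  have : ExteriorAlgebra.algebraMapInv
      (ExteriorAlgebra.ι ℂ (Pi.single s (1 : ℂ) : OddIdx → ℂ)) = 0 := by
    simp [ExteriorAlgebra.algebraMapInv]
  rw [this]; simp

theorem constPart_eta (j : Fin 7) : constPart (eta j) = 0 := by
  simp [constPart, eta]

theorem constPart_rescale (s : OddIdx → ℂ) (t : Fin 7 → ℂ) (x : Gr) :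
    constPart (rescale s t x) = constPart x := by
  induction x using gr_induction with
  | one => simp
  | add x y hx hy => simp only [map_add, hx, hy]
  | smul r x hx => rw [map_smul, map_smul, map_smul, hx]
  | odd j x hx => simp [rescale_oddGen, constPart_oddGen]
  | even j x hx => simp [rescale_eta, constPart_eta]

/-! ### Monomials in the odd generators and iterated odd derivatives -/

/-- The product of the odd generators with labels in `l`, in the order of the list. -/
def oddMon (l : List OddIdx) : Gr := (l.map oddGen).prod

/-- The composition of the odd derivatives with labels in `l`; the last one acts first. -/
def oddDer (l : List OddIdx) : Module.End ℂ Gr := (l.map dOdd).prod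

theorem oddMon_nil : oddMon [] = 1 := rfl

theorem oddMon_cons (s : OddIdx) (l : List OddIdx) : oddMon (s :: l) = oddGen s * oddMon l := by
  simp [oddMon]

theorem oddMon_append (l l' : List OddIdx) : oddMon (l ++ l') = oddMon l * oddMon l' := by
  simp [oddMon]

theorem oddDer_nil (x : Gr) : oddDer [] x = x := rfl

theorem oddDer_cons (s : OddIdx) (l : List OddIdx) (x : Gr) :
    oddDer (s :: l) x = dOdd s (oddDer l x) := by
  simp [oddDer]

theorem oddDer_append (l l' : List OddIdx) (x : Gr) :
    oddDer (l ++ l') x = oddDer l (oddDer l' x) := by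
  simp [oddDer]

theorem oddGen_mul_oddMon_of_mem {s : OddIdx} {l : List OddIdx} (h : s ∈ l) :
    oddGen s * oddMon l = 0 := by
  induction l with
  | nil => simp at h
  | cons t l ih =>
    rw [oddMon_cons]
    rcases List.mem_cons.1 h with rfl | h
    · exact oddGen_mul_self_mul _ _
    · rw [oddGen_mul_oddGen_mul, ih h, mul_zero, neg_zero]

theorem dOdd_oddMon_of_notMem {s : OddIdx} {l : List OddIdx} (h : s ∉ l) :
    dOdd s (oddMon l) = 0 := by
  induction l with
  | nil => exact dOdd_one s
  | cons t l ih =>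
    rw [List.mem_cons, not_or] at h
    rw [oddMon_cons, dOdd_oddGen_mul, if_neg h.1, ih h.2, mul_zero, sub_zero]

/-- A monomial is an eigenvector of the operators counting the odd generators it contains. -/
theorem oddGen_mul_dOdd_oddMon_of_mem {s : OddIdx} {l : List OddIdx} (h : s ∈ l) :
    oddGen s * dOdd s (oddMon l) = oddMon l := by
  have h1 := dOdd_oddGen_mul s s (oddMon l)
  rw [oddGen_mul_oddMon_of_mem h, map_zero, if_pos rfl] at h1
  exact (sub_eq_zero.1 h1.symm).symm

theorem dEta_oddMon (j : Fin 7) (l : List OddIdx) : dEta j (oddMon l) = 0 := by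
  induction l with
  | nil => exact dEta_one j
  | cons t l ih => rw [oddMon_cons, dEta_oddGen_mul, ih, mul_zero]

theorem rescale_oddMon (s : OddIdx → ℂ) (t : Fin 7 → ℂ) (l : List OddIdx) :
    rescale s t (oddMon l) = (l.map s).prod • oddMon l := by
  induction l with
  | nil => simp [oddMon]
  | cons k l ih =>
    rw [oddMon_cons, map_mul, ih, rescale_oddGen, smul_mul_smul_comm, List.map_cons,
      List.prod_cons]

theorem oddDer_rescale (s : OddIdx → ℂ) (t : Fin 7 → ℂ) (l : List OddIdx) (x : Gr) :
    oddDer l (rescale s t x) = (l.map s).prod • rescale s t (oddDer l x) := by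
  induction l with
  | nil => simp [oddDer]
  | cons k l ih =>
    rw [oddDer_cons, ih, map_smul, dOdd_rescale, oddDer_cons, List.map_cons, List.prod_cons,
      smul_smul, mul_comm]

theorem oddDer_eq_zero_of_mem {s : OddIdx} {l : List OddIdx} (h : s ∈ l) {x : Gr}
    (hx : dOdd s x = 0) : oddDer l x = 0 := by
  have hc : ∀ l' : List OddIdx, dOdd s (oddDer l' x) = 0 := by
    intro l'
    induction l' with
    | nil => exact hx
    | cons t l' ih => rw [oddDer_cons, dOdd_anticomm, ih, map_zero, neg_zero]
  induction l with
  | nil => simp at h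
  | cons t l ih =>
    rw [oddDer_cons]
    rcases List.mem_cons.1 h with rfl | h
    · exact hc l
    · rw [ih h, map_zero]

theorem oddMon_perm {l l' : List OddIdx} (h : l.Perm l') :
    ∃ ε : ℂ, ε ≠ 0 ∧ oddMon l = ε • oddMon l' := by
  induction h with
  | nil => exact ⟨1, one_ne_zero, by rw [one_smul]⟩
  | cons s _ ih =>
    obtain ⟨ε, h, e⟩ := ih
    exact ⟨ε, h, by rw [oddMon_cons, oddMon_cons, e, mul_smul_comm]⟩
  | swap s t l =>
    exact ⟨-1, by simp, by simp only [oddMon_cons]; rw [oddGen_mul_oddGen_mul, neg_one_smul]⟩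
  | trans _ _ ih₁ ih₂ =>
    obtain ⟨ε, h, e⟩ := ih₁
    obtain ⟨ε', h', e'⟩ := ih₂
    exact ⟨ε * ε', mul_ne_zero h h', by rw [e, e', smul_smul]⟩

theorem oddDer_perm {l l' : List OddIdx} (h : l.Perm l') :
    ∃ ε : ℂ, ε ≠ 0 ∧ ∀ x, oddDer l x = ε • oddDer l' x := by
  induction h with
  | nil => exact ⟨1, one_ne_zero, fun x => by rw [one_smul]⟩
  | cons s _ ih =>
    obtain ⟨ε, h, e⟩ := ih
    exact ⟨ε, h, fun x => by rw [oddDer_cons, oddDer_cons, e, map_smul]⟩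
  | swap s t l =>
    exact ⟨-1, by simp, fun x => by simp only [oddDer_cons]; rw [dOdd_anticomm, neg_one_smul]⟩
  | trans _ _ ih₁ ih₂ =>
    obtain ⟨ε, h, e⟩ := ih₁
    obtain ⟨ε', h', e'⟩ := ih₂
    exact ⟨ε * ε', mul_ne_zero h h', fun x => by rw [e, e', smul_smul]⟩

theorem oddDer_reverse_oddMon_append {l : List OddIdx} (h : l.Nodup) (l' : List OddIdx)
    (hd : l.Disjoint l') : oddDer l.reverse (oddMon (l ++ l')) = oddMon l' := by
  induction l with
  | nil => rfl
  | cons s l ih =>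
    rw [List.nodup_cons] at h
    rw [List.disjoint_cons_left] at hd
    have hs : s ∉ l ++ l' := by simp [h.1, hd.1]
    rw [List.reverse_cons, oddDer_append, oddDer_cons, oddDer_nil, List.cons_append, oddMon_cons,
      dOdd_oddGen_mul, if_pos rfl, dOdd_oddMon_of_notMem hs, mul_zero, sub_zero]
    exact ih h.2 hd.2

/-- Differentiating a monomial by all its generators gives a nonzero constant. -/
theorem exists_oddDer_oddMon {l l' : List OddIdx} (h : l.Nodup) (hp : l'.Perm l) :
    ∃ ε : ℂ, ε ≠ 0 ∧ oddDer l' (oddMon l) = ε • 1 := by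
  obtain ⟨ε, h0, e⟩ := oddDer_perm (hp.trans l.reverse_perm.symm)
  refine ⟨ε, h0, ?_⟩
  have := oddDer_reverse_oddMon_append h [] (List.disjoint_nil_right l)
  rw [List.append_nil] at this
  rw [e, this, oddMon_nil]

/-- The labels of the `θ_j`. -/
def thList : List OddIdx := List.ofFn fun j : Fin 7 => Sum.inl j

/-- The labels of the `θ̄_j`. -/
def tbList : List OddIdx := List.ofFn fun j : Fin 7 => Sum.inr (Sum.inl j)

/-- The labels of the `xi i`. -/
def xiList : List OddIdx := [Sum.inr (Sum.inr 0), Sum.inr (Sum.inr 1)]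

theorem tb_mem (j : Fin 7) : (Sum.inr (Sum.inl j) : OddIdx) ∈ tbList := by
  exact List.mem_ofFn.2 ⟨j, rfl⟩

theorem th_mem (j : Fin 7) : (Sum.inl j : OddIdx) ∈ thList := by
  exact List.mem_ofFn.2 ⟨j, rfl⟩

theorem xi_mem (i : Fin 2) : (Sum.inr (Sum.inr i) : OddIdx) ∈ xiList := by
  fin_cases i <;> simp [xiList]

theorem thList_map_prod {M : Type*} [CommMonoid M] (s : OddIdx → M) :
    (thList.map s).prod = ∏ j, s (Sum.inl j) := by
  rw [thList, List.map_ofFn, List.prod_ofFn]; rfl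

theorem tbList_map_prod {M : Type*} [CommMonoid M] (s : OddIdx → M) :
    (tbList.map s).prod = ∏ j, s (Sum.inr (Sum.inl j)) := by
  rw [tbList, List.map_ofFn, List.prod_ofFn]; rfl

theorem xiList_map_prod {M : Type*} [CommMonoid M] (s : OddIdx → M) :
    (xiList.map s).prod = ∏ i, s (Sum.inr (Sum.inr i)) := by
  simp [xiList]

theorem berezin_apply (x : Gr) : berezin x = constPart (oddDer (thList ++ tbList) x) := by
  simp only [berezin, oddDer, thList, tbList, List.map_append, List.prod_append, List.map_ofFn]
  rfl

theorem berezin_eq_zero_of_dOdd {s : OddIdx} (hs : s ∈ thList ++ tbList) {x : Gr}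
    (hx : dOdd s x = 0) : berezin x = 0 := by
  rw [berezin_apply, oddDer_eq_zero_of_mem hs hx, map_zero]

theorem berezin_rescale (s : OddIdx → ℂ) (t : Fin 7 → ℂ) (x : Gr) :
    berezin (rescale s t x) =
      (∏ j, s (Sum.inl j)) * (∏ j, s (Sum.inr (Sum.inl j))) * berezin x := by
  rw [berezin_apply, berezin_apply, oddDer_rescale, map_smul, constPart_rescale, List.map_append,
    List.prod_append, thList_map_prod, tbList_map_prod, smul_eq_mul]

/-! ### Contraction with the polyvector field of `μ` -/

/-- The polyvector field `θ̄_0 … θ̄_6 z̄*_0 z̄*_1`, the value of `μ` at each point. -/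
def muGr : Gr := oddMon (tbList ++ xiList)

theorem muGr_eq : muGr = (List.ofFn tb).prod * xi 0 * xi 1 := by
  rw [muGr, oddMon_append, mul_assoc]
  simp only [oddMon, tbList, xiList, List.map_ofFn, List.map_cons, List.map_nil, List.prod_cons,
    List.prod_nil, mul_one]
  rfl

theorem contrGen_single_inl (j : Fin 7) (w : ExteriorAlgebra ℂ (OddIdx → ℂ)) :
    contrGen (Pi.single (Sum.inl j) 1) w =
      ExteriorAlgebra.ι ℂ (Pi.single (Sum.inl j) (1 : ℂ)) * w := by
  have h1 : thPart (Pi.single (Sum.inl j) 1) = Pi.single (Sum.inl j) 1 := by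
    ext k
    rcases k with k | k | k <;> simp [thPart, Pi.single_apply]
  have h2 : xiPart (Pi.single (Sum.inl j) 1) = 0 := by
    simp [xiPart]
  simp [contrGen, h1, h2]

theorem contrGen_single_inr_inl (j : Fin 7) (w : ExteriorAlgebra ℂ (OddIdx → ℂ)) :
    contrGen (Pi.single (Sum.inr (Sum.inl j)) 1) w =
      ExteriorAlgebra.ι ℂ (Pi.single (Sum.inr (Sum.inl j)) (1 : ℂ)) * w := by
  have h1 : thPart (Pi.single (Sum.inr (Sum.inl j)) 1) = Pi.single (Sum.inr (Sum.inl j)) 1 := by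
    ext k
    rcases k with k | k | k <;> simp [thPart, Pi.single_apply]
  have h2 : xiPart (Pi.single (Sum.inr (Sum.inl j)) 1) = 0 := by
    simp [xiPart]
  simp [contrGen, h1, h2]

theorem contrGen_single_inr_inr (i : Fin 2) (w : ExteriorAlgebra ℂ (OddIdx → ℂ)) :
    contrGen (Pi.single (Sum.inr (Sum.inr i)) 1) w =
      CliffordAlgebra.contractLeft (Q := (0 : QuadraticForm ℂ (OddIdx → ℂ)))
        (LinearMap.proj (Sum.inr (Sum.inr i)) : Module.Dual ℂ (OddIdx → ℂ)) w := by
  have h1 : thPart (Pi.single (Sum.inr (Sum.inr i)) 1) = 0 := by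
    ext k
    rcases k with k | k | k <;> simp [thPart]
  have h2 : xiPart (Pi.single (Sum.inr (Sum.inr i)) 1) =
      (LinearMap.proj (Sum.inr (Sum.inr i)) : Module.Dual ℂ (OddIdx → ℂ)) := by
    ext v
    fin_cases i <;> simp [xiPart]
  simp [contrGen, h1, h2]

theorem contrGr_tmul (a b : MvPolynomial (Fin 7) ℂ) (u w : ExteriorAlgebra ℂ (OddIdx → ℂ)) :
    contrGr (a ⊗ₜ[ℂ] u) (b ⊗ₜ[ℂ] w) = contrPoly a b ⊗ₜ[ℂ] contrExt u w := rfl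

theorem contrGr_th_mul (j : Fin 7) (x y : Gr) :
    contrGr (oddGen (Sum.inl j) * x) y = oddGen (Sum.inl j) * contrGr x y := by
  induction x using TensorProduct.induction_on with
  | zero => simp
  | add a b ha hb =>
    rw [mul_add, map_add, map_add, LinearMap.add_apply, LinearMap.add_apply, ha, hb, mul_add]
  | tmul a u =>
    induction y using TensorProduct.induction_on with
    | zero => simp
    | add c d hc hd => rw [map_add, map_add, hc, hd, mul_add]
    | tmul b w =>
      simp only [oddGen, Algebra.TensorProduct.tmul_mul_tmul, one_mul, contrGr_tmul, map_mul,
        Module.End.mul_apply]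
      rw [contrExt, ExteriorAlgebra.lift_ι_apply, contrGen_single_inl]

theorem contrGr_tb_mul (j : Fin 7) (x y : Gr) :
    contrGr (oddGen (Sum.inr (Sum.inl j)) * x) y =
      oddGen (Sum.inr (Sum.inl j)) * contrGr x y := by
  induction x using TensorProduct.induction_on with
  | zero => simp
  | add a b ha hb =>
    rw [mul_add, map_add, map_add, LinearMap.add_apply, LinearMap.add_apply, ha, hb, mul_add]
  | tmul a u =>
    induction y using TensorProduct.induction_on with
    | zero => simp
    | add c d hc hd => rw [map_add, map_add, hc, hd, mul_add]
    | tmul b w =>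
      simp only [oddGen, Algebra.TensorProduct.tmul_mul_tmul, one_mul, contrGr_tmul, map_mul,
        Module.End.mul_apply]
      rw [contrExt, ExteriorAlgebra.lift_ι_apply, contrGen_single_inr_inl]

theorem contrGr_xi_mul (i : Fin 2) (x y : Gr) :
    contrGr (oddGen (Sum.inr (Sum.inr i)) * x) y =
      dOdd (Sum.inr (Sum.inr i)) (contrGr x y) := by
  induction x using TensorProduct.induction_on with
  | zero => simp
  | add a b ha hb =>
    rw [mul_add, map_add, map_add, LinearMap.add_apply, LinearMap.add_apply, ha, hb, map_add]
  | tmul a u =>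
    induction y using TensorProduct.induction_on with
    | zero => simp
    | add c d hc hd => rw [map_add, map_add, hc, hd, map_add]
    | tmul b w =>
      simp only [oddGen, Algebra.TensorProduct.tmul_mul_tmul, one_mul, contrGr_tmul, map_mul,
        Module.End.mul_apply]
      rw [contrExt, ExteriorAlgebra.lift_ι_apply, contrGen_single_inr_inr]
      rfl

theorem contrGr_one (y : Gr) : contrGr 1 y = y := by
  have h : contrPoly 1 = 1 := by
    have : (1 : MvPolynomial (Fin 7) ℂ) = MvPolynomial.basisMonomials (Fin 7) ℂ 0 := by simp
    rw [this, contrPoly, Module.Basis.constr_basis]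
    simp
  induction y using TensorProduct.induction_on with
  | zero => simp
  | add c d hc hd => rw [map_add, hc, hd]
  | tmul b w => rw [Algebra.TensorProduct.one_def, contrGr_tmul, h, map_one]; rfl

theorem contrPoly_X_mul_one (j : Fin 7) (a : MvPolynomial (Fin 7) ℂ) :
    contrPoly (MvPolynomial.X j * a) 1 = 0 := by
  have hpow : ∀ (k : Fin 7) (n : ℕ), n ≠ 0 →
      ((MvPolynomial.pderiv k).toLinearMap : Module.End ℂ (MvPolynomial (Fin 7) ℂ)) ^ n •
        (1 : MvPolynomial (Fin 7) ℂ) = 0 := by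
    intro k n hn
    obtain ⟨n, rfl⟩ := Nat.exists_eq_succ_of_ne_zero hn
    rw [pow_succ, mul_smul]
    simp
  have hlist : ∀ (m : Fin 7 →₀ ℕ) (l : List (Fin 7)),
      (∃ k ∈ l, m k ≠ 0) → (l.map fun k : Fin 7 =>
        ((MvPolynomial.pderiv k).toLinearMap : Module.End ℂ (MvPolynomial (Fin 7) ℂ)) ^ m k).prod •
          (1 : MvPolynomial (Fin 7) ℂ) = 0 := by
    intro m l
    induction l with
    | nil => simp
    | cons k l ih =>
      intro h
      rw [List.map_cons, List.prod_cons, mul_smul]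
      by_cases hl : ∃ k ∈ l, m k ≠ 0
      · rw [ih hl, smul_zero]
      · have hk : m k ≠ 0 := by
          obtain ⟨k', hk', h0⟩ := h
          rcases List.mem_cons.1 hk' with rfl | h'
          · exact h0
          · exact absurd ⟨k', h', h0⟩ hl
        push Not at hl
        rw [List.prod_eq_one, one_smul, hpow _ _ hk]
        intro x hx
        obtain ⟨k', hk', rfl⟩ := List.mem_map.1 hx
        rw [hl k' hk', pow_zero]
  induction a using MvPolynomial.induction_on' with
  | monomial m r =>
    have : MvPolynomial.X j * MvPolynomial.monomial m r =
        r • MvPolynomial.basisMonomials (Fin 7) ℂ (Finsupp.single j 1 + m) := by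
      rw [MvPolynomial.X, MvPolynomial.monomial_mul, MvPolynomial.coe_basisMonomials,
        MvPolynomial.smul_monomial]
      simp
    rw [this, map_smul, contrPoly, Module.Basis.constr_basis, List.ofFn_eq_map]
    have h2 := hlist (Finsupp.single j 1 + m) (List.finRange 7)
      ⟨j, List.mem_finRange j, by simp⟩
    rw [LinearMap.smul_apply, ← Module.End.smul_def, h2, smul_zero]
  | add p q hp hq => rw [mul_add, map_add, LinearMap.add_apply, hp, hq, add_zero]

theorem oddMon_eq_one_tmul (l : List OddIdx) :
    ∃ w : ExteriorAlgebra ℂ (OddIdx → ℂ), oddMon l = 1 ⊗ₜ[ℂ] w := by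
  induction l with
  | nil => exact ⟨1, rfl⟩
  | cons s l ih =>
    obtain ⟨w, hw⟩ := ih
    exact ⟨_, by rw [oddMon_cons, hw, oddGen, Algebra.TensorProduct.tmul_mul_tmul, one_mul]⟩

/-- A form with a factor `dθ̄_j` annihilates polyvectors without `θ̄*`. -/
theorem contrGr_eta_mul_oddMon (j : Fin 7) (x : Gr) (l : List OddIdx) :
    contrGr (eta j * x) (oddMon l) = 0 := by
  obtain ⟨w, hw⟩ := oddMon_eq_one_tmul l
  rw [hw]
  induction x using TensorProduct.induction_on with
  | zero => simp
  | add a b ha hb => rw [mul_add, map_add, LinearMap.add_apply, ha, hb, add_zero]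
  | tmul a u =>
    rw [eta, Algebra.TensorProduct.tmul_mul_tmul, contrGr_tmul, contrPoly_X_mul_one,
      TensorProduct.zero_tmul]

theorem tb_mul_muGr (j : Fin 7) : oddGen (Sum.inr (Sum.inl j)) * muGr = 0 :=
  oddGen_mul_oddMon_of_mem (List.mem_append_left _ (tb_mem j))

/-- The contraction of a form with `θ̄_0 … θ̄_6 z̄*_0 z̄*_1` is a multiple of `θ̄_0 … θ̄_6`. -/
theorem tb_mul_contrGr_muGr (j : Fin 7) (x : Gr) :
    oddGen (Sum.inr (Sum.inl j)) * contrGr x muGr = 0 := by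
  induction x using gr_induction with
  | one => rw [contrGr_one, tb_mul_muGr]
  | add x y hx hy => rw [map_add, LinearMap.add_apply, mul_add, hx, hy, add_zero]
  | smul r x hx => rw [map_smul, LinearMap.smul_apply, mul_smul_comm, hx, smul_zero]
  | odd s x hx =>
    rcases s with s | s | s
    · rw [contrGr_th_mul, oddGen_mul_oddGen_mul, hx, mul_zero, neg_zero]
    · rw [contrGr_tb_mul, oddGen_mul_oddGen_mul, hx, mul_zero, neg_zero]
    · have h := dOdd_oddGen_mul (Sum.inr (Sum.inr s)) (Sum.inr (Sum.inl j)) (contrGr x muGr)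
      rw [hx, map_zero, if_neg (by simp), zero_sub] at h
      rw [contrGr_xi_mul, ← neg_eq_zero, ← h]
  | even k x hx => rw [muGr, contrGr_eta_mul_oddMon, mul_zero]

/-- The density at a point of `X` obtained from the value of a form there by contraction with `μ`
and integration along the odd fibre. Up to sign, this is the coefficient of
`θ_0 … θ_6 dz̄_0 dz̄_1`. -/
def topCoeff : Gr →ₗ[ℂ] ℂ := berezin ∘ₗ contrGr.flip muGr

theorem topCoeff_apply (x : Gr) : topCoeff x = berezin (contrGr x muGr) := rfl

theorem topCoeff_tb_mul (j : Fin 7) (x : Gr) : topCoeff (oddGen (Sum.inr (Sum.inl j)) * x) = 0 := by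
  rw [topCoeff_apply, contrGr_tb_mul, tb_mul_contrGr_muGr, map_zero]

theorem topCoeff_eta_mul (j : Fin 7) (x : Gr) : topCoeff (eta j * x) = 0 := by
  rw [topCoeff_apply, muGr, contrGr_eta_mul_oddMon, map_zero]

/-- `∂/∂θ_j` commutes with the contraction with `μ`, as `μ` does not involve `θ_j`. -/
theorem contrGr_dTh_muGr (j : Fin 7) (x : Gr) :
    contrGr (dOdd (Sum.inl j) x) muGr = dOdd (Sum.inl j) (contrGr x muGr) := by
  induction x using gr_induction with
  | one =>
    rw [dOdd_one, contrGr_one, muGr, dOdd_oddMon_of_notMem, map_zero, LinearMap.zero_apply]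
    simp [tbList, xiList]
  | add x y hx hy => simp only [map_add, LinearMap.add_apply, hx, hy]
  | smul r x hx => simp only [map_smul, LinearMap.smul_apply, hx]
  | odd s x hx =>
    rcases s with s | s | s
    · rw [contrGr_th_mul, dOdd_oddGen_mul, dOdd_oddGen_mul, map_sub, LinearMap.sub_apply,
        contrGr_th_mul, hx]
      split_ifs <;> simp
    · rw [contrGr_tb_mul, dOdd_oddGen_mul, dOdd_oddGen_mul, map_sub, LinearMap.sub_apply,
        contrGr_tb_mul, hx]
      simp
    · rw [contrGr_xi_mul, dOdd_oddGen_mul, dOdd_anticomm, map_sub, LinearMap.sub_apply,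
        contrGr_xi_mul, hx]
      simp
  | even k x hx =>
    rw [dOdd_eta_mul, muGr, contrGr_eta_mul_oddMon, contrGr_eta_mul_oddMon, map_zero]

/-- Only forms containing every `θ_j` contribute to the integral. -/
theorem topCoeff_eq_zero_of_dTh {j : Fin 7} {x : Gr} (h : dOdd (Sum.inl j) x = 0) :
    topCoeff x = 0 := by
  rw [topCoeff_apply]
  apply berezin_eq_zero_of_dOdd (List.mem_append_left _ (th_mem j))
  rw [← contrGr_dTh_muGr, h, map_zero, LinearMap.zero_apply]

/-- Contraction with `μ` intertwines a rescaling of forms with the dual rescaling of polyvectors;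
the factor is the weight of `μ`, written without division. -/
theorem prod_smul_contrGr_rescale_muGr (s : OddIdx → ℂ) (t : Fin 7 → ℂ)
    (hs : ∀ i, s (Sum.inr (Sum.inr i)) ≠ 0) (x : Gr) :
    (∏ j, s (Sum.inr (Sum.inl j))) • contrGr (rescale s t x) muGr =
      (∏ i, s (Sum.inr (Sum.inr i))) •
        rescale (Sum.elim (fun j => s (Sum.inl j)) (Sum.elim (fun j => s (Sum.inr (Sum.inl j)))
          (fun i => (s (Sum.inr (Sum.inr i)))⁻¹))) (fun _ => 1) (contrGr x muGr) := by
  induction x using gr_induction with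
  | one =>
    rw [map_one, contrGr_one, muGr, rescale_oddMon, List.map_append, List.prod_append,
      tbList_map_prod, xiList_map_prod, smul_smul]
    congr 1
    simp only [Sum.elim_inr, Sum.elim_inl, Finset.prod_inv_distrib]
    have : ∏ i, s (Sum.inr (Sum.inr i)) ≠ 0 := Finset.prod_ne_zero_iff.2 fun i _ => hs i
    field_simp
  | add x y hx hy => simp only [map_add, LinearMap.add_apply, smul_add, hx, hy]
  | smul r x hx =>
    simp only [map_smul, LinearMap.smul_apply]
    rw [smul_comm, hx, smul_comm]
  | odd k x hx =>
    rw [map_mul, rescale_oddGen, smul_mul_assoc, map_smul, LinearMap.smul_apply, smul_comm]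
    rcases k with k | k | k
    · rw [contrGr_th_mul, contrGr_th_mul, ← mul_smul_comm, hx, map_mul, rescale_oddGen,
        mul_smul_comm, smul_mul_assoc, smul_comm]
      rfl
    · rw [contrGr_tb_mul, contrGr_tb_mul, ← mul_smul_comm, hx, map_mul, rescale_oddGen,
        mul_smul_comm, smul_mul_assoc, smul_comm]
      rfl
    · rw [contrGr_xi_mul, contrGr_xi_mul, ← map_smul (dOdd _), hx, map_smul (dOdd _),
        dOdd_rescale, smul_comm, smul_smul (s _)]
      simp only [Sum.elim_inr]
      rw [mul_inv_cancel₀ (hs k), one_smul]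
  | even k x hx =>
    rw [map_mul, rescale_eta, smul_mul_assoc, map_smul, LinearMap.smul_apply, muGr,
      contrGr_eta_mul_oddMon, contrGr_eta_mul_oddMon, map_zero, smul_zero, smul_zero, smul_zero]

theorem topCoeff_rescale (s : OddIdx → ℂ) (t : Fin 7 → ℂ)
    (hs : ∀ i, s (Sum.inr (Sum.inr i)) ≠ 0) (hs' : ∀ j, s (Sum.inr (Sum.inl j)) ≠ 0) (x : Gr) :
    topCoeff (rescale s t x) =
      (∏ j, s (Sum.inl j)) * (∏ i, s (Sum.inr (Sum.inr i))) * topCoeff x := by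
  have h := congrArg berezin (prod_smul_contrGr_rescale_muGr s t hs x)
  have h0 : ∏ j, s (Sum.inr (Sum.inl j)) ≠ 0 := Finset.prod_ne_zero_iff.2 fun i _ => hs' i
  rw [map_smul, map_smul, berezin_rescale, smul_eq_mul, smul_eq_mul] at h
  simp only [Sum.elim_inl, Sum.elim_inr] at h
  rw [topCoeff_apply, topCoeff_apply]
  apply mul_left_cancel₀ h0
  rw [h]
  ring

/-- The monomial `θ_0 … θ_6 dz̄_0 dz̄_1`. -/
def topMon : Gr := oddMon (thList ++ xiList)

theorem contrGr_oddMon_thList_mul (l : List (Fin 7)) (x y : Gr) :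
    contrGr (oddMon (l.map Sum.inl) * x) y = oddMon (l.map Sum.inl) * contrGr x y := by
  induction l with
  | nil => simp [oddMon]
  | cons j l ih => rw [List.map_cons, oddMon_cons, mul_assoc, contrGr_th_mul, ih, mul_assoc]

theorem topCoeff_topMon_ne_zero : topCoeff topMon ≠ 0 := by
  have hth : thList = (List.finRange 7).map Sum.inl := by rw [thList, List.ofFn_eq_map]
  have hth' : thList.Nodup := List.nodup_ofFn.2 Sum.inl_injective
  have htb : tbList.Nodup := List.nodup_ofFn.2 (Sum.inr_injective.comp Sum.inl_injective)
  have hd : thList.Disjoint tbList := by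
    intro s h1 h2
    obtain ⟨_, rfl⟩ := List.mem_ofFn.1 h1
    obtain ⟨_, h⟩ := List.mem_ofFn.1 h2
    simp at h
  have hd' : xiList.Disjoint tbList := by
    intro s h1 h2
    obtain ⟨_, rfl⟩ := List.mem_ofFn.1 h2
    simp [xiList] at h1
  obtain ⟨ε₁, h₁, e₁⟩ := oddMon_perm (List.perm_append_comm (l₁ := tbList)
    (l₂ := xiList) |>.trans ((xiList.reverse_perm.symm).append_right tbList))
  have hK : contrGr topMon muGr = ε₁ • oddMon (thList ++ tbList) := by
    have hxi : contrGr (oddMon xiList) muGr = oddDer xiList muGr := by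
      rw [xiList, oddMon_cons, oddMon_cons, oddMon_nil, contrGr_xi_mul, contrGr_xi_mul,
        contrGr_one, oddDer_cons, oddDer_cons, oddDer_nil]
    have h2 := oddDer_reverse_oddMon_append (l := xiList.reverse) (by simp [xiList]) tbList
      (by simpa using hd')
    rw [List.reverse_reverse] at h2
    rw [topMon, oddMon_append, hth, contrGr_oddMon_thList_mul, hxi, muGr, e₁, map_smul, h2,
      mul_smul_comm, ← oddMon_append]
  obtain ⟨ε₂, h₂, e₂⟩ := exists_oddDer_oddMon (hth'.append htb hd) (List.Perm.refl _)
  rw [topCoeff_apply, hK, map_smul, berezin_apply, e₂]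
  simp [h₁, h₂]

/-! ### Coordinate changes on generators -/

/-- The factors by which `formT i p` rescales the odd generators. -/
def oddScale (i : Fin 2) (p : Pt) : OddIdx → ℂ :=
  Sum.elim (fun j => gFun i p j)
    (Sum.elim (fun j => star (gFun i p j)) (fun k => if k = i then star (kappa i p) else 1))

theorem gFun_ne_zero {i : Fin 2} {p : Pt} (hp : p i ≠ 0) (j : Fin 7) : gFun i p j ≠ 0 :=
  zpow_ne_zero _ hp

theorem kappa_ne_zero {i : Fin 2} {p : Pt} (hp : p i ≠ 0) : kappa i p ≠ 0 :=
  inv_ne_zero (pow_ne_zero _ hp)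

/-- The canonical bundle of `X` and the determinant of `F` are inverse to each other. -/
theorem prod_gFun {i : Fin 2} {p : Pt} (hp : p i ≠ 0) : ∏ j, gFun i p j = kappa i p := by
  rw [Fin.prod_univ_seven]
  fin_cases i <;> simp at hp <;> simp [gFun, wt, kappa] <;> field_simp

theorem berC_eq_one {i : Fin 2} {p : Pt} (hp : p i ≠ 0) : berC i p = 1 := by
  rw [berC, Finset.prod_inv_distrib, prod_gFun hp, mul_inv_cancel₀ (kappa_ne_zero hp)]

theorem formT_eq (i : Fin 2) (p : Pt) (x : Gr) :
    formT i p x = shearForm i (fun j => star (logDerivG i p j))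
      (rescale (oddScale i p) (fun j => star (gFun i p j)) x) := rfl

theorem formT_oddGen (i : Fin 2) (p : Pt) (s : OddIdx) :
    formT i p (oddGen s) = oddScale i p s • oddGen s := by
  rw [formT_eq, rescale_oddGen, map_smul, shearForm_apply]
  simp [dEta_oddGen]

theorem formT_eta (i : Fin 2) (p : Pt) (j : Fin 7) :
    formT i p (eta j) =
      star (gFun i p j) • eta j + (star (gFun i p j) * star (logDerivG i p j)) • (xi i * tb j) := by
  rw [formT_eq, rescale_eta, map_smul, shearForm_apply, smul_add, mul_smul]
  congr 2
  simp [dEta_eta]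

theorem formT_oddGen_mul (i : Fin 2) (p : Pt) (s : OddIdx) (x : Gr) :
    formT i p (oddGen s * x) = oddScale i p s • (oddGen s * formT i p x) := by
  rw [formT_mul, formT_oddGen, smul_mul_assoc]

theorem topCoeff_formT {i : Fin 2} {p : Pt} (hp : p i ≠ 0) (x : Gr) :
    topCoeff (formT i p x) = kappa i p * star (kappa i p) * topCoeff x := by
  have hs : ∀ y : Gr, topCoeff (∑ j : Fin 7, star (logDerivG i p j) • (xi i * tb j * dEta j y)) =
      0 := by
    intro y
    rw [map_sum]
    refine Finset.sum_eq_zero fun j _ => ?_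
    have : xi i * tb j = -(tb j * xi i) := oddGen_anticomm _ _
    rw [map_smul, this, neg_mul, mul_assoc, map_neg, tb, topCoeff_tb_mul, neg_zero, smul_zero]
  rw [formT_eq, shearForm_apply, map_add, hs, add_zero, topCoeff_rescale]
  · congr 2
    · exact prod_gFun hp
    · fin_cases i <;> simp [oddScale]
  · intro k
    simp only [oddScale, Sum.elim_inr]
    split_ifs
    · exact star_ne_zero.2 (kappa_ne_zero hp)
    · exact one_ne_zero
  · exact fun j => star_ne_zero.2 (gFun_ne_zero hp j)

theorem dOdd_inl_formT (i : Fin 2) (p : Pt) (j : Fin 7) (x : Gr) :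
    dOdd (Sum.inl j) (formT i p x) = gFun i p j • formT i p (dOdd (Sum.inl j) x) := by
  have h : ∀ k y, dOdd (Sum.inl j) (xi i * tb k * y) = xi i * tb k * dOdd (Sum.inl j) y := by
    intro k y
    rw [mul_assoc, mul_assoc, xi, dOdd_oddGen_mul, tb, dOdd_oddGen_mul]
    simp
  rw [formT_eq, formT_eq, shearForm_apply, shearForm_apply, map_add, dOdd_rescale, smul_add,
    map_sum, Finset.smul_sum]
  congr 1
  refine Finset.sum_congr rfl fun k _ => ?_
  rw [map_smul, h, ← dEta_dOdd, dOdd_rescale, map_smul, mul_smul_comm, smul_comm]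
  rfl

/-- `id_T` is a global section of `Λ²H* ⊗ O(1,1)`. -/
theorem formT_idT {i : Fin 2} (p : Pt) : formT i p idT = (p i)⁻¹ • idT := by
  have h : ∀ j k : Fin 7, formT i p (th j * th k) =
      (gFun i p j * gFun i p k) • (th j * th k) := by
    intro j k
    rw [th, formT_oddGen_mul, th, formT_oddGen, mul_smul_comm, smul_smul]
    rfl
  rw [idT, map_add, map_add, h, h, h, smul_add, smul_add]
  fin_cases i <;> simp [gFun, wt]

/-! ### Evaluation of local sections -/

theorem ev_tmul (p : Pt) (f : Sm) (x : Gr) : ev p (f ⊗ₜ[ℂ] x) = f.1 p • x := by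
  simp [ev]

theorem ev_const (p : Pt) (x : Gr) : ev p (const x) = x := by
  rw [const, ev_tmul]
  exact one_smul ℂ x

theorem ev_onGr (p : Pt) (L : Gr →ₗ[ℂ] Gr) (σ : Loc) : ev p (onGr L σ) = L (ev p σ) := by
  induction σ using TensorProduct.induction_on with
  | zero => simp
  | add a b ha hb => simp only [map_add, ha, hb]
  | tmul f x => rw [onGr, LinearMap.lTensor_tmul, ev_tmul, ev_tmul, map_smul]

theorem ev_contr (p : Pt) (σ τ : Loc) : ev p (contr σ τ) = contrGr (ev p σ) (ev p τ) := by
  induction σ using TensorProduct.induction_on with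
  | zero => simp
  | add a b ha hb => simp only [map_add, LinearMap.add_apply, ha, hb]
  | tmul f x =>
    induction τ using TensorProduct.induction_on with
    | zero => simp
    | add a b ha hb => simp only [map_add, ha, hb]
    | tmul g y =>
      have : contr (f ⊗ₜ[ℂ] x) (g ⊗ₜ[ℂ] y) = (f * g) ⊗ₜ[ℂ] contrGr x y := rfl
      rw [this, ev_tmul, ev_tmul, ev_tmul, map_smul, map_smul, LinearMap.smul_apply, smul_smul,
        mul_comm]
      rfl

theorem tensor_eq_zero_of_dual {V G : Type*} [AddCommGroup V] [Module ℂ V] [AddCommGroup G]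
    [Module ℂ G] {ρ : V ⊗[ℂ] G} (h : ∀ φ : Module.Dual ℂ G, LinearMap.lTensor V φ ρ = 0) :
    ρ = 0 := by
  let b := Module.Free.chooseBasis ℂ G
  have hb : ∀ (ρ : V ⊗[ℂ] G) k, TensorProduct.equivFinsuppOfBasisRight (M := V) b ρ k =
      TensorProduct.rid ℂ V (LinearMap.lTensor V (b.coord k) ρ) := by
    intro ρ k
    induction ρ using TensorProduct.induction_on with
    | zero => simp
    | add x y hx hy => rw [map_add, Finsupp.add_apply, hx, hy, map_add, map_add]
    | tmul f x => simp
  apply (TensorProduct.equivFinsuppOfBasisRight (M := V) b).injective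
  ext1 k
  rw [hb, h, map_zero, map_zero, Finsupp.zero_apply]

/-- The smooth function obtained from a local section by a linear functional on `Gr`. -/
def comp (φ : Module.Dual ℂ Gr) : Loc →ₗ[ℂ] Sm :=
  (TensorProduct.rid ℂ Sm).toLinearMap ∘ₗ LinearMap.lTensor Sm φ

theorem comp_apply (φ : Module.Dual ℂ Gr) (σ : Loc) (p : Pt) : (comp φ σ).1 p = φ (ev p σ) := by
  induction σ using TensorProduct.induction_on with
  | zero => simp
  | add x y hx hy =>
    rw [map_add, map_add, map_add, ← hx, ← hy]
    rfl
  | tmul f x =>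
    rw [ev_tmul, map_smul, smul_eq_mul, mul_comm]
    rfl

/-- A local section is determined by its values. -/
theorem loc_ext {σ τ : Loc} (h : ∀ p, ev p σ = ev p τ) : σ = τ := by
  rw [← sub_eq_zero]
  refine tensor_eq_zero_of_dual fun φ => ?_
  apply (TensorProduct.rid ℂ Sm).injective
  rw [map_zero]
  refine Subtype.ext (funext fun p => ?_)
  refine (comp_apply φ (σ - τ) p).trans ?_
  rw [map_sub, h, sub_self, map_zero]
  rfl

/-! ### Wirtinger derivatives -/

theorem wirtinger_congr {k : Fin 2} {f g : Pt → ℂ} {p : Pt} (h : f =ᶠ[nhds p] g) :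
    wirtinger k f p = wirtinger k g p := by
  rw [wirtinger, wirtinger, h.fderiv_eq]

theorem wirtinger_mul {k : Fin 2} {f g : Pt → ℂ} {p : Pt} (hf : DifferentiableAt ℝ f p)
    (hg : DifferentiableAt ℝ g p) :
    wirtinger k (fun q => f q * g q) p = wirtinger k f p * g p + f p * wirtinger k g p := by
  have : fderiv ℝ (fun q => f q * g q) p = f p • fderiv ℝ g p + g p • fderiv ℝ f p :=
    fderiv_fun_mul hf hg
  simp only [wirtinger, this, add_apply, smul_apply, smul_eq_mul]
  ring

theorem wirtinger_add {k : Fin 2} {f g : Pt → ℂ} {p : Pt} (hf : DifferentiableAt ℝ f p)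
    (hg : DifferentiableAt ℝ g p) :
    wirtinger k (fun q => f q + g q) p = wirtinger k f p + wirtinger k g p := by
  have : fderiv ℝ (fun q => f q + g q) p = fderiv ℝ f p + fderiv ℝ g p := fderiv_fun_add hf hg
  simp only [wirtinger, this, add_apply]
  ring

theorem wirtinger_const (k : Fin 2) (c : ℂ) (p : Pt) : wirtinger k (fun _ => c) p = 0 := by
  simp [wirtinger]

theorem hasFDerivAt_coord {f : ℂ → ℂ} {f' : ℂ} {i : Fin 2} {p : Pt} (hf : HasDerivAt f f' (p i)) :
    HasFDerivAt (fun q : Pt => f (q i)) 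
      (f' • ContinuousLinearMap.proj (R := ℂ) (φ := fun _ : Fin 2 => ℂ) i) p :=
  hf.comp_hasFDerivAt p
    (ContinuousLinearMap.proj (R := ℂ) (φ := fun _ : Fin 2 => ℂ) i).hasFDerivAt

theorem holomorphic_coord {f : ℂ → ℂ} {f' : ℂ} {i : Fin 2} {p : Pt} (hf : HasDerivAt f f' (p i)) :
    DifferentiableAt ℝ (fun q : Pt => f (q i)) p ∧
      ∀ k, wirtinger k (fun q : Pt => f (q i)) p = 0 := by
  have h := (hasFDerivAt_coord hf).restrictScalars ℝ
  refine ⟨h.differentiableAt, fun k => ?_⟩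
  rw [wirtinger, h.fderiv]
  by_cases hk : i = k
  · subst hk
    simp
    linear_combination f' * Complex.I_mul_I
  · simp [Pi.single_eq_of_ne hk]

theorem antiholomorphic_coord {f : ℂ → ℂ} {f' : ℂ} {i : Fin 2} {p : Pt}
    (hf : HasDerivAt f f' (p i)) :
    DifferentiableAt ℝ (fun q : Pt => star (f (q i))) p ∧
      ∀ k, wirtinger k (fun q : Pt => star (f (q i))) p = if k = i then star f' else 0 := by
  have h := Complex.conjCLE.toContinuousLinearMap.hasFDerivAt.comp p
    ((hasFDerivAt_coord hf).restrictScalars ℝ)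
  have h' : HasFDerivAt (fun q : Pt => star (f (q i))) _ p := h
  refine ⟨h'.differentiableAt, fun k => ?_⟩
  rw [wirtinger, h'.fderiv]
  by_cases hk : k = i
  · subst hk
    simp
    linear_combination (-(starRingEnd ℂ) f' / 2) * Complex.I_mul_I
  · simp [hk]

theorem flip_eq (i : Fin 2) (q : Pt) :
    flip i q = fun k => if k = i then -(q k)⁻¹ else q k := by
  funext k
  by_cases h : k = i
  · subst h; simp [flip]
  · simp [flip, h]

theorem flip_self (i : Fin 2) (q : Pt) : flip i q i = -(q i)⁻¹ := by simp [flip]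

theorem hasFDerivAt_flip {i : Fin 2} {p : Pt} (hp : p i ≠ 0) :
    HasFDerivAt (flip i) (ContinuousLinearMap.pi fun k =>
      (if k = i then kappa i p else 1) •
        ContinuousLinearMap.proj (R := ℂ) (φ := fun _ : Fin 2 => ℂ) k) p := by
  have : flip i = fun q k => if k = i then -(q k)⁻¹ else q k := funext fun q => flip_eq i q
  rw [this, hasFDerivAt_pi]
  intro k
  by_cases h : k = i
  · subst h
    simp only [if_true]
    have := (hasDerivAt_inv hp).neg
    rw [neg_neg] at this
    exact hasFDerivAt_coord this
  · simp only [h, if_false, one_smul]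
    exact (ContinuousLinearMap.proj (R := ℂ) (φ := fun _ : Fin 2 => ℂ) k).hasFDerivAt

/-- The chain rule for the coordinate change: `∂/∂z̄_i` is multiplied by `κ̄`. -/
theorem wirtinger_comp_flip {i : Fin 2} {p : Pt} (hp : p i ≠ 0) {f : Pt → ℂ}
    (hf : Differentiable ℝ f) :
    DifferentiableAt ℝ (fun q => f (flip i q)) p ∧ ∀ k, wirtinger k (fun q => f (flip i q)) p =
      (if k = i then star (kappa i p) else 1) * wirtinger k f (flip i p) := by
  have h := (hf (flip i p)).hasFDerivAt.comp p ((hasFDerivAt_flip hp).restrictScalars ℝ)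
  have h' : HasFDerivAt (fun q => f (flip i q)) _ p := h
  refine ⟨h'.differentiableAt, fun k => ?_⟩
  rw [wirtinger, h'.fderiv]
  have hA : ∀ c : ℂ, (ContinuousLinearMap.pi fun l =>
      (if l = i then kappa i p else 1) •
        ContinuousLinearMap.proj (R := ℂ) (φ := fun _ : Fin 2 => ℂ) l) (Pi.single k c : Pt) =
      Pi.single k ((if k = i then kappa i p else 1) * c) := by
    intro c
    funext l
    by_cases hl : l = k
    · subst hl
      simp only [ContinuousLinearMap.coe_pi', Pi.single_eq_same, smul_apply,
        ContinuousLinearMap.proj_apply, smul_eq_mul]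
    · simp only [ContinuousLinearMap.coe_pi', Pi.single_eq_of_ne hl, smul_apply,
        ContinuousLinearMap.proj_apply, smul_zero]
  have hs : ∀ c : ℂ, fderiv ℝ f (flip i p) (Pi.single k c) =
      c.re * fderiv ℝ f (flip i p) (Pi.single k 1) +
        c.im * fderiv ℝ f (flip i p) (Pi.single k Complex.I) := by
    intro c
    have : (Pi.single k c : Pt) =
        c.re • (Pi.single k 1 : Pt) + c.im • (Pi.single k Complex.I : Pt) := by
      rw [← Pi.single_smul', ← Pi.single_smul', ← Pi.single_add]
      congr 1
      simp
    rw [this, map_add, map_smul, map_smul]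
    simp
  simp only [ContinuousLinearMap.comp_apply, ContinuousLinearMap.coe_restrictScalars', hA]
  rw [wirtinger, hs, hs (_ * Complex.I)]
  have hstar : (if k = i then star (kappa i p) else 1) = star (if k = i then kappa i p else 1) := by
    split_ifs <;> simp
  rw [hstar]
  generalize (if k = i then kappa i p else 1) = a
  have ha : star a = a.re - a.im * Complex.I := by
    apply Complex.ext <;> simp
  rw [ha]
  simp only [mul_one, Complex.mul_re, Complex.mul_im, Complex.I_re, Complex.I_im, mul_zero,
    zero_sub, add_zero, Complex.ofReal_neg]
  linear_combination (a.im * fderiv ℝ f (flip i p) (Pi.single k Complex.I) / 2) * Complex.I_mul_I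

/-! ### Derivatives of `Gr`-valued functions -/

/-- `d k` is the derivative `∂/∂z̄_k` at `p` of the `Gr`-valued function `G`. As `Gr` carries no
topology, this is tested against all linear functionals. -/
def HasDbar (G : Pt → Gr) (p : Pt) (d : Fin 2 → Gr) : Prop :=
  ∀ φ : Module.Dual ℂ Gr, DifferentiableAt ℝ (fun q => φ (G q)) p ∧
    ∀ k, wirtinger k (fun q => φ (G q)) p = φ (d k)

theorem hasDbar_const (x : Gr) (p : Pt) : HasDbar (fun _ => x) p 0 := fun φ =>
  ⟨differentiableAt_const _, fun k => by rw [wirtinger_const, Pi.zero_apply, map_zero]⟩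

theorem HasDbar.add {G H : Pt → Gr} {p : Pt} {d e : Fin 2 → Gr} (hG : HasDbar G p d)
    (hH : HasDbar H p e) : HasDbar (fun q => G q + H q) p (d + e) := by
  intro φ
  simp only [map_add, Pi.add_apply]
  refine ⟨(hG φ).1.add (hH φ).1, fun k => ?_⟩
  rw [wirtinger_add (hG φ).1 (hH φ).1, (hG φ).2, (hH φ).2]

theorem HasDbar.smul {G : Pt → Gr} {f : Pt → ℂ} {p : Pt} {d : Fin 2 → Gr}
    (hf : DifferentiableAt ℝ f p) (hG : HasDbar G p d) :
    HasDbar (fun q => f q • G q) p (fun k => wirtinger k f p • G p + f p • d k) := by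
  intro φ
  simp only [map_add, map_smul, smul_eq_mul]
  refine ⟨hf.mul (hG φ).1, fun k => ?_⟩
  rw [wirtinger_mul hf (hG φ).1, (hG φ).2]

theorem HasDbar.map (L : Gr →ₗ[ℂ] Gr) {G : Pt → Gr} {p : Pt} {d : Fin 2 → Gr}
    (hG : HasDbar G p d) : HasDbar (fun q => L (G q)) p (fun k => L (d k)) :=
  fun φ => hG (φ ∘ₗ L)

theorem HasDbar.unique {G H : Pt → Gr} {p : Pt} {d e : Fin 2 → Gr} (hG : HasDbar G p d)
    (hH : HasDbar H p e) (h : G =ᶠ[nhds p] H) : d = e := by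
  funext k
  rw [← sub_eq_zero, ← Module.forall_dual_apply_eq_zero_iff ℂ]
  intro φ
  rw [map_sub, ← (hG φ).2, ← (hH φ).2, sub_eq_zero]
  exact wirtinger_congr (h.fun_comp φ)

theorem hasDbar_ev (σ : Loc) (p : Pt) :
    HasDbar (fun q => ev q σ) p (fun k => ev p (dZb k σ)) := by
  induction σ using TensorProduct.induction_on with
  | zero =>
    simp only [map_zero]
    exact hasDbar_const 0 p
  | add a b ha hb =>
    simp only [map_add]
    exact ha.add hb
  | tmul f x =>
    have h := HasDbar.smul (differentiable_of_Sm f p) (hasDbar_const x p)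
    simp only [Pi.zero_apply, smul_zero, add_zero] at h
    simp only [ev_tmul, dZb, LinearMap.rTensor_tmul]
    exact h

/-- The part `∑ dθ̄_j ∂/∂θ̄_j` of `∂̄` along the odd fibres. -/
def dbarFib : Gr →ₗ[ℂ] Gr := ∑ j : Fin 7, LinearMap.mulLeft ℂ (eta j) ∘ₗ dTb j

theorem dbarFib_apply (x : Gr) : dbarFib x = ∑ j : Fin 7, eta j * dTb j x := by
  simp [dbarFib, LinearMap.sum_apply]

theorem ev_dbar (p : Pt) (σ : Loc) :
    ev p (dbar σ) = ∑ k, xi k * ev p (dZb k σ) + dbarFib (ev p σ) := by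
  simp only [dbar, LinearMap.add_apply, LinearMap.sum_apply, LinearMap.comp_apply,
    LinearMap.mulLeft_apply, map_add, map_sum, map_mul, ev_const, ev_onGr, dbarFib_apply]

/-- The values of `dbarFib` on the odd generators. -/
def dbarGen : OddIdx → Gr := Sum.elim (fun _ => 0) (Sum.elim eta (fun _ => 0))

theorem dbarFib_oddGen_mul (s : OddIdx) (x : Gr) :
    dbarFib (oddGen s * x) = dbarGen s * x - oddGen s * dbarFib x := by
  have h : ∀ j, eta j * (oddGen s * dTb j x) = oddGen s * (eta j * dTb j x) := by
    intro j
    rw [← mul_assoc, ← eta_comm, mul_assoc]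
  rw [dbarFib_apply, dbarFib_apply, Finset.mul_sum]
  simp only [dTb, dOdd_oddGen_mul, mul_sub, Finset.sum_sub_distrib]
  congr 1
  · rcases s with s | s | s
    · simp [dbarGen]
    · simp [dbarGen]
    · simp [dbarGen]
  · exact Finset.sum_congr rfl fun j _ => h j

theorem dbarFib_eta_mul (j : Fin 7) (x : Gr) : dbarFib (eta j * x) = eta j * dbarFib x := by
  rw [dbarFib_apply, dbarFib_apply, Finset.mul_sum]
  refine Finset.sum_congr rfl fun k _ => ?_
  rw [dTb, dOdd_eta_mul, ← mul_assoc, ← mul_assoc, eta_comm]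

theorem dbarFib_one : dbarFib 1 = 0 := by
  simp [dbarFib_apply, dTb, dOdd_one]

theorem hasDerivAt_zpow_neg (m : ℤ) {z : ℂ} (hz : z ≠ 0) :
    HasDerivAt (fun z : ℂ => z ^ (-m)) (-(m : ℂ) / z * z ^ (-m)) z := by
  have h := hasDerivAt_zpow (-m) z (Or.inl hz)
  have e : ((-m : ℤ) : ℂ) * z ^ (-m - 1) = -(m : ℂ) / z * z ^ (-m) := by
    rw [zpow_sub_one₀ hz]
    push_cast
    field_simp
  rwa [e] at h

/-! ### The Dolbeault operator is compatible with coordinate changes -/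

theorem wirtinger_star_gFun {i : Fin 2} {p : Pt} (hp : p i ≠ 0) (j : Fin 7) :
    DifferentiableAt ℝ (fun q => star (gFun i q j)) p ∧
      ∀ k, wirtinger k (fun q => star (gFun i q j)) p =
        if k = i then star (gFun i p j) * star (logDerivG i p j) else 0 := by
  have h := antiholomorphic_coord (hasDerivAt_zpow_neg (wt j i) hp)
  refine ⟨h.1, fun k => (h.2 k).trans ?_⟩
  rw [star_mul]
  rfl

theorem wirtinger_star_logDerivG {i : Fin 2} {p : Pt} (hp : p i ≠ 0) (j : Fin 7) :
    DifferentiableAt ℝ (fun q => star (logDerivG i q j)) p ∧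
      ∀ k, k ≠ i → wirtinger k (fun q => star (logDerivG i q j)) p = 0 := by
  have h := antiholomorphic_coord ((hasDerivAt_inv hp).const_mul (-(wt j i : ℂ)))
  exact ⟨h.1, fun k hk => (h.2 k).trans (if_neg hk)⟩

/-- The rescaling of each odd generator is compatible with `∂̄`. -/
theorem oddScale_dbar {i : Fin 2} {p : Pt} (hp : p i ≠ 0) (s : OddIdx) :
    DifferentiableAt ℝ (fun q => oddScale i q s) p ∧
      ∑ k, wirtinger k (fun q => oddScale i q s) p • (xi k * oddGen s) +
        oddScale i p s • dbarGen s = formT i p (dbarGen s) := by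
  rcases s with j | j | l
  · have h := holomorphic_coord (hasDerivAt_zpow_neg (wt j i) hp)
    have h2 : ∀ k, wirtinger k (fun q => oddScale i q (Sum.inl j)) p = 0 := h.2
    refine ⟨h.1, ?_⟩
    simp [h2, dbarGen]
  · have h := wirtinger_star_gFun hp j
    have h2 : ∀ k, wirtinger k (fun q => oddScale i q (Sum.inr (Sum.inl j))) p =
      if k = i then star (gFun i p j) * star (logDerivG i p j) else 0 := h.2
    refine ⟨h.1, ?_⟩
    simp only [h2, ite_smul, zero_smul, Finset.sum_ite_eq', Finset.mem_univ, if_true, dbarGen,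
      Sum.elim_inr, Sum.elim_inl, formT_eta]
    rw [add_comm]
    rfl
  · by_cases hl : l = i
    · subst hl
      have h := antiholomorphic_coord (i := l) (p := p) ((hasDerivAt_pow 2 (p l)).inv
        (pow_ne_zero 2 hp))
      have he : (fun q : Pt => oddScale l q (Sum.inr (Sum.inr l))) =
          fun q => star (((fun z : ℂ => z ^ 2)⁻¹) (q l)) := by
        funext q
        simp [oddScale, kappa]
      rw [he]
      refine ⟨h.1, ?_⟩
      simp only [h.2, ite_smul, zero_smul, Finset.sum_ite_eq', Finset.mem_univ, if_true, dbarGen,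
        Sum.elim_inr, map_zero, smul_zero, add_zero]
      rw [xi, oddGen_sq, smul_zero]
    · have he : (fun q : Pt => oddScale i q (Sum.inr (Sum.inr l))) = fun q => 1 := by
        funext q
        simp [oddScale, hl]
      rw [he]
      refine ⟨differentiableAt_const _, ?_⟩
      simp [wirtinger_const, dbarGen]

/-- For a constant form, `∂̄` commutes with the change of coordinates. -/
theorem dbar_formT {i : Fin 2} {p : Pt} (hp : p i ≠ 0) (x : Gr) :
    ∃ d, HasDbar (fun q => formT i q x) p d ∧
      ∑ k, xi k * d k + dbarFib (formT i p x) = formT i p (dbarFib x) := by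
  induction x using gr_induction with
  | one =>
    refine ⟨0, ?_, ?_⟩
    · simp only [formT_one]
      exact hasDbar_const 1 p
    · simp [formT_one, dbarFib_one]
  | add x y hx hy =>
    obtain ⟨d, hd, hx⟩ := hx
    obtain ⟨e, he, hy⟩ := hy
    refine ⟨d + e, ?_, ?_⟩
    · simp only [map_add]
      exact hd.add he
    · simp only [map_add, Pi.add_apply, mul_add, Finset.sum_add_distrib, ← hx, ← hy]
      abel
  | smul r x hx =>
    obtain ⟨d, hd, hx⟩ := hx
    refine ⟨fun k => r • d k, ?_, ?_⟩
    · simp only [map_smul]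
      exact hd.map (r • LinearMap.id)
    · simp only [map_smul, mul_smul_comm, ← Finset.smul_sum, ← hx, smul_add]
  | odd s x hx =>
    obtain ⟨d, hd, hx⟩ := hx
    obtain ⟨hc, hs⟩ := oddScale_dbar hp s
    have hH := HasDbar.smul hc (hd.map (LinearMap.mulLeft ℂ (oddGen s)))
    simp only [LinearMap.mulLeft_apply, ← formT_oddGen_mul] at hH
    refine ⟨_, hH, ?_⟩
    rw [formT_oddGen_mul, map_smul, dbarFib_oddGen_mul, dbarFib_oddGen_mul, map_sub, formT_mul,
      formT_oddGen_mul, ← hs, ← hx]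
    simp only [mul_add, mul_smul_comm, add_mul, Finset.sum_mul, smul_mul_assoc,
      Finset.sum_add_distrib, smul_sub, smul_add, Finset.smul_sum, Finset.mul_sum, mul_assoc]
    have : ∀ k, xi k * (oddGen s * d k) = -(oddGen s * (xi k * d k)) :=
      fun k => oddGen_mul_oddGen_mul _ _ _
    simp only [this, smul_neg, Finset.sum_neg_distrib]
    abel
  | even j x hx =>
    obtain ⟨d, hd, hx⟩ := hx
    obtain ⟨hg, hg'⟩ := wirtinger_star_gFun hp j
    obtain ⟨hl, hl'⟩ := wirtinger_star_logDerivG hp j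
    have hgl : DifferentiableAt ℝ (fun q => star (gFun i q j) * star (logDerivG i q j)) p :=
      hg.mul hl
    have hgl' : ∀ k, k ≠ i →
        wirtinger k (fun q => star (gFun i q j) * star (logDerivG i q j)) p = 0 := by
      intro k hk
      rw [wirtinger_mul hg hl, hg', hl' k hk, if_neg hk]
      simp
    have hF : ∀ (q : Pt) (y : Gr), formT i q (eta j * y) =
        star (gFun i q j) • (eta j * formT i q y) +
        (star (gFun i q j) * star (logDerivG i q j)) • (xi i * tb j * formT i q y) := by
      intro q y
      rw [formT_mul, formT_eta, add_mul, smul_mul_assoc, smul_mul_assoc]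
    have hH := (HasDbar.smul hg (hd.map (LinearMap.mulLeft ℂ (eta j)))).add
      (HasDbar.smul hgl (hd.map (LinearMap.mulLeft ℂ (xi i * tb j))))
    simp only [LinearMap.mulLeft_apply, ← hF] at hH
    refine ⟨_, hH, ?_⟩
    have h1 : ∀ k y, xi k * (eta j * y) = eta j * (xi k * y) := by
      intro k y
      rw [← mul_assoc, eta_comm, mul_assoc]
    have h2 : ∀ k y, xi k * (xi i * (tb j * y)) = xi i * (tb j * (xi k * y)) := by
      intro k y
      rw [xi, xi, tb, oddGen_mul_oddGen_mul, oddGen_mul_oddGen_mul _ (Sum.inr (Sum.inl j)),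
        mul_neg, neg_neg]
    have h3 : ∀ y, xi i * (xi i * y) = 0 := fun y => oddGen_mul_self_mul _ _
    have h4 : dbarFib (xi i * (tb j * formT i p x)) =
        xi i * (tb j * dbarFib (formT i p x)) - xi i * (eta j * formT i p x) := by
      rw [xi, dbarFib_oddGen_mul, tb, dbarFib_oddGen_mul]
      simp only [dbarGen, Sum.elim_inr, Sum.elim_inl, zero_mul, mul_sub]
      abel
    have h5 : ∀ k, wirtinger k (fun q => star (gFun i q j) * star (logDerivG i q j)) p •
        (xi k * (xi i * (tb j * formT i p x))) = 0 := by
      intro k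
      by_cases hk : k = i
      · subst hk
        rw [h3, smul_zero]
      · rw [hgl' k hk, zero_smul]
    rw [hF, dbarFib_eta_mul, hF, map_add, map_smul, map_smul, dbarFib_eta_mul, mul_assoc, h4,
      ← hx]
    have h6 : ∑ k, wirtinger k (fun q => star (gFun i q j)) p • (eta j * (xi k * formT i p x)) =
        (star (gFun i p j) * star (logDerivG i p j)) • (xi i * (eta j * formT i p x)) := by
      simp only [hg', ite_smul, zero_smul, Finset.sum_ite_eq', Finset.mem_univ, if_true, h1]
    simp only [Pi.add_apply, mul_add, mul_smul_comm,
      Finset.sum_add_distrib, smul_sub, smul_add, Finset.smul_sum, Finset.mul_sum, mul_assoc, h2,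
      h1, h6]
    have h7 : ∀ k, wirtinger k (fun q => star (gFun i q j) * star (logDerivG i q j)) p •
        (xi i * (tb j * (xi k * formT i p x))) = 0 := fun k => by rw [← h2, h5]
    simp only [h7, Finset.sum_const_zero]
    abel

/-- `∂̄` commutes with the change of coordinates. -/
theorem dbar_formT_ev {i : Fin 2} {p : Pt} (hp : p i ≠ 0) (σ : Loc) :
    ∃ d, HasDbar (fun q => formT i q (ev (flip i q) σ)) p d ∧
      ∑ k, xi k * d k + dbarFib (formT i p (ev (flip i p) σ)) =
        formT i p (ev (flip i p) (dbar σ)) := by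
  induction σ using TensorProduct.induction_on with
  | zero =>
    refine ⟨0, ?_, ?_⟩
    · simp only [map_zero]
      exact hasDbar_const 0 p
    · simp
  | add x y hx hy =>
    obtain ⟨d, hd, hx⟩ := hx
    obtain ⟨e, he, hy⟩ := hy
    refine ⟨d + e, ?_, ?_⟩
    · simp only [map_add]
      exact hd.add he
    · simp only [map_add, Pi.add_apply, mul_add, Finset.sum_add_distrib, ← hx, ← hy]
      abel
  | tmul f x =>
    obtain ⟨d, hd, hx⟩ := dbar_formT hp x
    obtain ⟨hf, hf'⟩ := wirtinger_comp_flip hp (differentiable_of_Sm f)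
    refine ⟨fun k => wirtinger k (fun q => f.1 (flip i q)) p • formT i p x +
      f.1 (flip i p) • d k, ?_, ?_⟩
    · simp only [ev_tmul, map_smul]
      exact hd.smul hf
    · have hw : ∀ k, (dbarSm k f).1 (flip i p) = wirtinger k f.1 (flip i p) := fun _ => rfl
      have hs : ∀ k, oddScale i p (Sum.inr (Sum.inr k)) = if k = i then star (kappa i p) else 1 :=
        fun _ => rfl
      have hxi : ∀ k y, formT i p (xi k * y) =
          (if k = i then star (kappa i p) else 1) • (xi k * formT i p y) :=
        fun k y => formT_oddGen_mul i p _ y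
      rw [ev_dbar]
      simp only [ev_tmul, map_smul, dZb, LinearMap.rTensor_tmul, map_add, map_sum, ← hx, hw,
        mul_smul_comm, hxi, hf', mul_add, Finset.sum_add_distrib, smul_smul, mul_comm,
        Finset.smul_sum, smul_add]
      rw [add_assoc]

/-- `∂̄` acts on forms with values in a holomorphic line bundle. -/
theorem Glued.dbar {χ : Fin 2 → Pt → ℂ} {σ : Chart → Loc} (hσ : Glued formT χ σ)
    (hχ : ∀ i p, p i ≠ 0 → DifferentiableAt ℝ (χ i) p ∧ ∀ k, wirtinger k (χ i) p = 0) :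
    Glued formT χ fun c => dbar (σ c) := by
  intro c i p hc hp
  obtain ⟨d, hd, h⟩ := dbar_formT_ev hp (σ (Function.update c i true))
  obtain ⟨hχ1, hχ2⟩ := hχ i p hp
  have he : (fun q => ev q (σ c)) =ᶠ[nhds p]
      fun q => χ i q • formT i q (ev (flip i q) (σ (Function.update c i true))) := by
    have hopen : ∀ᶠ q : Pt in nhds p, q i ≠ 0 :=
      (continuous_apply i).continuousAt.eventually_ne hp
    filter_upwards [hopen] with q hq using hσ c i q hc hq
  have hu := (hasDbar_ev (σ c) p).unique (hd.smul hχ1) he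
  rw [ev_dbar, ← h, hσ c i p hc hp, map_smul, smul_add, Finset.smul_sum]
  congr 1
  refine Finset.sum_congr rfl fun k _ => ?_
  rw [congrFun hu k, hχ2, zero_smul, zero_add, mul_smul_comm]

theorem holomorphic_zpow (d : Fin 2 → ℤ) (i : Fin 2) (p : Pt) (hp : p i ≠ 0) :
    DifferentiableAt ℝ (fun q : Pt => q i ^ d i) p ∧
      ∀ k, wirtinger k (fun q : Pt => q i ^ d i) p = 0 :=
  holomorphic_coord (hasDerivAt_zpow (d i) (p i) (Or.inl hp))

/-! ### The deformation `α = W ∂/∂θ` -/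

/-- The fibre of `Λ²H* ⊗ Θ* ⊗ Λ²` of the cotangent space: the values of `W`. -/
def wFibre : Submodule ℂ Gr :=
  Submodule.span ℂ (Set.range fun a : Fin 6 × Fin 6 =>
    th a.1.castSucc * (th a.2.castSucc * (xi 0 * xi 1)))

theorem wFibre_mem (a b : Fin 6) : th a.castSucc * (th b.castSucc * (xi 0 * xi 1)) ∈ wFibre :=
  Submodule.subset_span ⟨(a, b), rfl⟩

theorem xi_mul_xi_mem (a b : Fin 6) (k l : Fin 2) :
    th a.castSucc * (th b.castSucc * (xi k * xi l)) ∈ wFibre := by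
  have h0 : ∀ k, xi k * xi k = 0 := fun k => oddGen_sq _
  have h1 : xi 1 * xi 0 = -(xi 0 * xi 1) := oddGen_anticomm _ _
  fin_cases k <;> fin_cases l
  · simp [h0]
  · exact wFibre_mem a b
  · simp only [Fin.mk_one, Fin.zero_eta, h1, mul_neg]
    exact neg_mem (wFibre_mem a b)
  · simp [h0]

theorem ev_mem_wFibre {W : Chart → Loc} (hW : RepresentsFundamentalClass W) (c : Chart) (p : Pt) :
    ev p (W c) ∈ wFibre := by
  obtain ⟨φ, B, hφ, -, hB, h⟩ := hW
  rw [h, map_add]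
  refine add_mem ?_ ?_
  · obtain ⟨f, hf⟩ := hφ.2 c
    rw [hf, map_mul, ev_const, ev_tmul, mul_smul_comm, idT, add_mul, add_mul, mul_assoc, mul_assoc,
      mul_assoc]
    exact Submodule.smul_mem _ _ (add_mem (add_mem (wFibre_mem 0 3) (wFibre_mem 1 4))
      (wFibre_mem 2 5))
  · obtain ⟨b, hb⟩ := hB.2 c
    rw [hb]
    simp only [map_sum]
    refine sum_mem fun i _ => sum_mem fun j _ => sum_mem fun k _ => ?_
    have h0 : dbarFib (th i.castSucc * th j.castSucc * xi k) = 0 := by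
      have h1 : dbarFib (xi k) = 0 := by
        have := dbarFib_oddGen_mul (Sum.inr (Sum.inr k)) 1
        simp only [mul_one, dbarGen, Sum.elim_inr, dbarFib_one, mul_zero,
          sub_zero] at this
        exact this
      rw [mul_assoc, th, dbarFib_oddGen_mul, th, dbarFib_oddGen_mul, h1]
      simp [dbarGen]
    rw [ev_dbar, ev_tmul, map_smul, h0, smul_zero, add_zero]
    refine sum_mem fun l _ => ?_
    rw [dZb, LinearMap.rTensor_tmul, ev_tmul, mul_smul_comm]
    refine Submodule.smul_mem _ _ ?_
    have : xi l * (th i.castSucc * th j.castSucc * xi k) =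
        th i.castSucc * (th j.castSucc * (xi l * xi k)) := by
      rw [mul_assoc, xi, th, oddGen_mul_oddGen_mul, th, oddGen_mul_oddGen_mul (Sum.inr (Sum.inr l)),
        mul_neg, neg_neg]
    rw [this]
    exact xi_mul_xi_mem i j l k

/-- Elements of `wFibre` are even and do not contain `θ_6`. -/
theorem dOdd_mul_of_mem_wFibre {w : Gr} (hw : w ∈ wFibre) (x : Gr) :
    dOdd (Sum.inl 6) (w * x) = w * dOdd (Sum.inl 6) x := by
  induction hw using Submodule.span_induction with
  | mem w hw =>
    obtain ⟨⟨a, b⟩, rfl⟩ := hw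
    have ha : ∀ a : Fin 6, (6 : Fin 7) ≠ a.castSucc := fun a => (Fin.castSucc_lt_last a).ne'
    simp only [mul_assoc, th, xi, dOdd_oddGen_mul]
    simp [ha]
  | zero => simp
  | add u v _ _ hu hv => rw [add_mul, add_mul, map_add, hu, hv]
  | smul r u _ hu => rw [smul_mul_assoc, smul_mul_assoc, map_smul, hu]

theorem topCoeff_alpha {w : Gr} (hw : w ∈ wFibre) (x : Gr) :
    topCoeff (w * dOdd (Sum.inl 6) x) = 0 := by
  apply topCoeff_eq_zero_of_dTh (j := 6)
  rw [dOdd_mul_of_mem_wFibre hw, dOdd_dOdd_self, mul_zero]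

/-- The contraction with an element of `wFibre` applies `∂/∂z̄*_0`, which squares to zero. -/
theorem dOdd_xi_contrGr {w : Gr} (hw : w ∈ wFibre) (x : Gr) :
    dOdd (Sum.inr (Sum.inr 0)) (contrGr w x) = 0 := by
  induction hw using Submodule.span_induction with
  | mem w hw =>
    obtain ⟨⟨a, b⟩, rfl⟩ := hw
    simp only [th, xi, contrGr_th_mul, contrGr_xi_mul, dOdd_oddGen_mul, dOdd_dOdd_self]
    simp
  | zero => simp
  | add u v _ _ hu hv => rw [map_add, LinearMap.add_apply, map_add, hu, hv, add_zero]
  | smul r u _ hu => rw [map_smul, LinearMap.smul_apply, map_smul, hu, smul_zero]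

/-- `W` is a form with values in `Θ* = O(-1,-1)`. -/
theorem RepresentsFundamentalClass.glued {W : Chart → Loc} (hW : RepresentsFundamentalClass W) :
    Glued formT (fun i p => (p i) ^ (-1 : ℤ)) W := by
  obtain ⟨φ, B, hφ, -, hB, h⟩ := hW
  have hdB := Glued.dbar hB.1 (fun i p hp => holomorphic_zpow (fun _ => -1) i p hp)
  intro c i p hc hp
  rw [h, h, map_add, map_add, map_add, smul_add, hdB c i p hc hp, map_mul, map_mul, ev_const,
    ev_const, hφ.1 c i p hc hp, formT_mul, formT_idT, mul_smul_comm, smul_mul_assoc, smul_smul]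
  congr 2
  simp only [zpow_neg, zpow_one]
  rw [show (2 : ℤ) = 1 + 1 from rfl, zpow_add₀ hp, zpow_one, mul_inv]

theorem ev_dForm (W a : Chart → Loc) (c : Chart) (p : Pt) :
    ev p (dForm W a c) =
      ev p (dbar (a c)) + ev p (W c) * dOdd (Sum.inl 6) (ev p (a c)) := by
  have : dForm W a c = dbar (a c) + W c * onGr (dTh 6) (a c) := rfl
  rw [this, map_add, map_mul, ev_onGr]
  rfl

theorem glued_of_mem_Dolb {a : Chart → Loc} (ha : a ∈ Dolb) : Glued formT (fun _ _ => 1) a := ha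

theorem dForm_mem_Dolb {W : Chart → Loc} (hW : RepresentsFundamentalClass W) {a : Chart → Loc}
    (ha : a ∈ Dolb) : dForm W a ∈ Dolb := by
  have h1 := Glued.dbar (glued_of_mem_Dolb ha) fun i p _ =>
    ⟨differentiableAt_const _, fun k => wirtinger_const k 1 p⟩
  intro c i p hc hp
  have h2 := hW.glued c i p hc hp
  have h3 := h1 c i p hc hp
  have h4 := glued_of_mem_Dolb ha c i p hc hp
  simp only [one_smul] at h3 h4 ⊢
  rw [ev_dForm, ev_dForm, h2, h3, h4, map_add, formT_mul, dOdd_inl_formT, smul_mul_smul_comm]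
  have : p i ^ (-1 : ℤ) * gFun i p 6 = 1 := by
    fin_cases i <;> simp [gFun, wt] <;> exact inv_mul_cancel₀ hp
  rw [this, one_smul]

/-- The operator `D` on the Dolbeault algebra. -/
def dDolb (W : Chart → Loc) (hW : RepresentsFundamentalClass W) : Dolb →ₗ[ℂ] Dolb where
  toFun a := ⟨dForm W a.1, dForm_mem_Dolb hW a.2⟩
  map_add' a b := Subtype.ext (map_add (dForm W) a.1 b.1)
  map_smul' r a := Subtype.ext (map_smul (dForm W) r a.1)

/-! ### The integral form `μ` -/

theorem mu_apply (c : Chart) : mu c = const muGr := by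
  rw [mu, Pi.mul_apply, volF, cBar, one_mul, muGr_eq]

theorem ev_mu (p : Pt) (c : Chart) : ev p (mu c) = muGr := by
  rw [mu_apply, ev_const]

theorem polyT_muGr {i : Fin 2} {p : Pt} (hp : p i ≠ 0) : polyT i p muGr = muGr := by
  have h0 : ∀ j, tb j * eta j * dXi i muGr = 0 := by
    intro j
    have h := dOdd_oddGen_mul (Sum.inr (Sum.inr i)) (Sum.inr (Sum.inl j)) muGr
    rw [tb_mul_muGr, map_zero, if_neg (by simp), zero_sub, eq_comm, neg_eq_zero] at h
    rw [eta_comm, mul_assoc]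
    exact (congrArg (eta j * ·) h).trans (mul_zero _)
  have h1 : ∀ l, shearPoly i l muGr = muGr := by
    intro l
    simp only [shearPoly, LinearMap.add_apply, LinearMap.id_apply, LinearMap.sum_apply,
      LinearMap.smul_apply, LinearMap.comp_apply, LinearMap.mulLeft_apply, h0, smul_zero,
      Finset.sum_const_zero, add_zero]
  have hk := star_ne_zero.2 (kappa_ne_zero hp)
  rw [polyT, LinearMap.comp_apply, AlgHom.toLinearMap_apply, muGr, rescale_oddMon, ← muGr,
    map_smul, h1, List.map_append, List.prod_append, tbList_map_prod, xiList_map_prod]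
  simp only [Sum.elim_inr, Sum.elim_inl]
  rw [← star_prod, prod_gFun hp, Finset.prod_ite_eq' Finset.univ i, if_pos (Finset.mem_univ _),
    mul_inv_cancel₀ hk, one_smul]

theorem mu_mem_intForms : mu ∈ intForms := by
  intro c i p _ hp
  rw [ev_mu, ev_mu, polyT_muGr hp]
  simp [berC_eq_one hp]

theorem euler_muGr : euler muGr = (2 : ℂ) • muGr := by
  have h : ∀ i, xi i * dXi i muGr = muGr := fun i =>
    oddGen_mul_dOdd_oddMon_of_mem (List.mem_append_right _ (xi_mem i))
  simp only [euler, LinearMap.add_apply, LinearMap.sum_apply, LinearMap.comp_apply,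
    LinearMap.mulLeft_apply, h]
  simp [muGr, dEta_oddMon, two_smul]

theorem isIntForm_mu : IsIntForm 2 mu := by
  refine ⟨mu_mem_intForms, fun c => loc_ext fun p => ?_⟩
  rw [ev_onGr, map_smul, ev_mu, euler_muGr]
  rfl

theorem ev_dInt (W ν : Chart → Loc) (c : Chart) (p : Pt) :
    ev p (dInt W ν c) = ∑ i, dXi i (ev p (dZb i (ν c))) + ∑ j, dEta j (dTb j (ev p (ν c))) +
      dTh 6 (contrGr (ev p (W c)) (ev p (ν c))) := by
  have : dInt W ν c = dbarInt (ν c) + onGr (dTh 6) (contr (W c) (ν c)) := rfl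
  simp only [this, dbarInt, LinearMap.add_apply, LinearMap.sum_apply, LinearMap.comp_apply,
    map_add, map_sum, ev_onGr, ev_contr]

theorem dInt_mu {W : Chart → Loc} (hW : RepresentsFundamentalClass W) : dInt W mu = 0 := by
  funext c
  refine loc_ext fun p => ?_
  have h1 : ∀ i, ev p (dZb i (mu c)) = 0 := by
    intro i
    have h2 : HasDbar (fun q => ev q (mu c)) p 0 := by
      simp only [ev_mu]
      exact hasDbar_const _ _
    exact congrFun ((hasDbar_ev (mu c) p).unique h2 Filter.EventuallyEq.rfl) i
  have h3 : dOdd (Sum.inl 6) (ev p (W c)) = 0 := by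
    have := dOdd_mul_of_mem_wFibre (ev_mem_wFibre hW c p) 1
    rwa [mul_one, dOdd_one, mul_zero] at this
  have h4 : dTh 6 (contrGr (ev p (W c)) muGr) = 0 := by
    rw [dTh, ← contrGr_dTh_muGr, h3, map_zero, LinearMap.zero_apply]
  have h5 : ∀ j, dEta j (dTb j muGr) = 0 := by
    intro j
    rw [dTb, dEta_dOdd, muGr, dEta_oddMon, map_zero]
  rw [ev_dInt, ev_mu, h4]
  simp [h1, h5]

/-- The coefficient of `θ̄_0 … θ̄_6 z̄*_0 z̄*_1` vanishes on the image of `D`: each term of the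
divergence loses one of the `z̄*_i` or one of the `θ̄_j`, and `α` loses both `z̄*_0` and `z̄*_1`. -/
theorem oddDer_dInt {W : Chart → Loc} (hW : RepresentsFundamentalClass W) (ν : Chart → Loc)
    (c : Chart) (p : Pt) : oddDer (tbList ++ xiList) (ev p (dInt W ν c)) = 0 := by
  rw [ev_dInt, map_add, map_add, map_sum, map_sum]
  have h1 : ∀ i x, oddDer (tbList ++ xiList) (dXi i x) = 0 := fun i x =>
    oddDer_eq_zero_of_mem (List.mem_append_right _ (xi_mem i)) (dOdd_dOdd_self _ _)
  have h2 : ∀ j x, oddDer (tbList ++ xiList) (dEta j (dTb j x)) = 0 := by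
    intro j x
    refine oddDer_eq_zero_of_mem (List.mem_append_left _ (tb_mem j)) ?_
    rw [← dEta_dOdd, dTb, dOdd_dOdd_self, map_zero]
  have h3 : oddDer (tbList ++ xiList) (dTh 6 (contrGr (ev p (W c)) (ev p (ν c)))) = 0 := by
    refine oddDer_eq_zero_of_mem (List.mem_append_right _ (xi_mem 0)) ?_
    rw [dTh, dOdd_anticomm, dOdd_xi_contrGr (ev_mem_wFibre hW c p), map_zero, neg_zero]
  simp [h1, h2, h3]

theorem tbList_append_xiList_nodup : (tbList ++ xiList).Nodup := by
  refine List.Nodup.append (List.nodup_ofFn.2 (Sum.inr_injective.comp Sum.inl_injective))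
    (by simp [xiList]) ?_
  intro s h1 h2
  obtain ⟨_, rfl⟩ := List.mem_ofFn.1 h1
  simp [xiList] at h2

theorem oddDer_muGr_ne_zero : oddDer (tbList ++ xiList) muGr ≠ 0 := by
  obtain ⟨ε, h0, h⟩ := exists_oddDer_oddMon tbList_append_xiList_nodup (List.Perm.refl _)
  intro h1
  rw [muGr, h] at h1
  have := congrArg constPart h1
  simp [h0] at this

theorem mu_ne_zero : mu ≠ 0 := by
  intro h
  have h1 : ev 0 (mu bigCell) = 0 := by rw [h]; exact map_zero _
  rw [ev_mu] at h1
  exact oddDer_muGr_ne_zero (by rw [h1, map_zero])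

theorem dInt_ne_mu {W : Chart → Loc} (hW : RepresentsFundamentalClass W) (ν : Chart → Loc) :
    dInt W ν ≠ mu := by
  intro h
  have h1 := oddDer_dInt hW ν bigCell 0
  rw [h, ev_mu] at h1
  exact oddDer_muGr_ne_zero h1

/-! ### Decay at infinity and Stokes' theorem on `ℂ²` -/

open MeasureTheory Filter Topology

/-- If a quantity is bounded by `M` on the unit disc, and outside of it equals `|x|⁻ᵐ` times a
quantity bounded by `M`, then it decays like `(1 + |x|)⁻ᵐ`. -/
theorem le_of_flip {A M : ℝ} {x : ℂ} {m : ℕ} (hM : 0 ≤ M) (h1 : ‖x‖ ≤ 1 → A ≤ M)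
    (h2 : 1 < ‖x‖ → ∃ A' ≤ M, A = (‖x‖ ^ m)⁻¹ * A') :
    A ≤ M * 2 ^ m * ((1 + ‖x‖) ^ m)⁻¹ := by
  have hpos : 0 < (1 + ‖x‖) ^ m := by positivity
  rw [← div_eq_mul_inv, le_div_iff₀ hpos]
  rcases le_or_gt ‖x‖ 1 with h | h
  · have h3 : (1 + ‖x‖) ^ m ≤ 2 ^ m := pow_le_pow_left₀ (by positivity) (by linarith) m
    exact mul_le_mul (h1 h) h3 hpos.le hM
  · obtain ⟨A', hA', rfl⟩ := h2 h
    have hx : 0 < ‖x‖ ^ m := by positivity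
    have h3 : (1 + ‖x‖) ^ m ≤ 2 ^ m * ‖x‖ ^ m := by
      rw [← mul_pow]
      exact pow_le_pow_left₀ (by positivity) (by linarith) m
    have h4 : (‖x‖ ^ m)⁻¹ * (1 + ‖x‖) ^ m ≤ 2 ^ m := by
      rwa [inv_mul_le_iff₀ hx, mul_comm]
    calc (‖x‖ ^ m)⁻¹ * A' * (1 + ‖x‖) ^ m = A' * ((‖x‖ ^ m)⁻¹ * (1 + ‖x‖) ^ m) := by ring
      _ ≤ M * ((‖x‖ ^ m)⁻¹ * (1 + ‖x‖) ^ m) :=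
        mul_le_mul_of_nonneg_right hA' (by positivity)
      _ ≤ M * 2 ^ m := mul_le_mul_of_nonneg_left h4 hM

theorem norm_flip_self_le {i : Fin 2} {p : Pt} (h : 1 < ‖p i‖) : ‖flip i p i‖ ≤ 1 := by
  rw [flip_self, norm_neg, norm_inv]
  exact inv_le_one_of_one_le₀ h.le

/-- Compactness of `X`: scalar functions on the patches that are related by factors of modulus
`|z_i|⁻ᵐ` decay at infinity on the large cell. -/
theorem exists_decay {v : Chart → Pt → ℂ} (hv : ∀ c, Continuous (v c)) (m : Fin 2 → ℕ)
    (h : ∀ (c : Chart) (i : Fin 2) (p : Pt), c i = false → p i ≠ 0 →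
      ‖v c p‖ = (‖p i‖ ^ m i)⁻¹ * ‖v (Function.update c i true) (flip i p)‖) :
    ∃ C, 0 ≤ C ∧ ∀ p, ‖v bigCell p‖ ≤ C * ∏ i, ((1 + ‖p i‖) ^ m i)⁻¹ := by
  have hK : ∃ K, 0 ≤ K ∧ ∀ c, ∀ p : Pt, ‖p 0‖ ≤ 1 → ‖p 1‖ ≤ 1 → ‖v c p‖ ≤ K := by
    have hb : ∀ c, ∃ K, ∀ p ∈ Metric.closedBall (0 : Pt) 1, ‖v c p‖ ≤ K := fun c =>
      (isCompact_closedBall 0 1).exists_bound_of_continuousOn (hv c).continuousOn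
    choose K hK using hb
    refine ⟨∑ c, |K c|, Finset.sum_nonneg fun _ _ => abs_nonneg _, fun c p h0 h1 => ?_⟩
    have hp : p ∈ Metric.closedBall (0 : Pt) 1 := by
      rw [mem_closedBall_zero_iff, pi_norm_le_iff_of_nonneg zero_le_one, Fin.forall_fin_two]
      exact ⟨h0, h1⟩
    exact (hK c p hp).trans ((le_abs_self _).trans
      (Finset.single_le_sum (f := fun c => |K c|) (fun _ _ => abs_nonneg _) (Finset.mem_univ c)))
  obtain ⟨K, hK0, hK⟩ := hK
  have ne_zero : ∀ {x : ℂ}, 1 < ‖x‖ → x ≠ 0 := fun hx h0 => by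
    rw [h0, norm_zero] at hx
    linarith
  -- the coordinate `z_r` is replaced by `-1 / z_r` where it is large, then `z_l`
  have hA : ∀ c : Chart, c 1 = false → ∀ p : Pt, ‖p 0‖ ≤ 1 →
      ‖v c p‖ ≤ K * 2 ^ m 1 * ((1 + ‖p 1‖) ^ m 1)⁻¹ := by
    intro c hc p hp
    refine le_of_flip hK0 (hK c p hp) fun h1 => ⟨_, ?_, h c 1 p hc (ne_zero h1)⟩
    refine hK _ _ ?_ (norm_flip_self_le h1)
    simpa [flip] using hp
  refine ⟨K * 2 ^ m 1 * 2 ^ m 0, by positivity, fun p => ?_⟩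
  have hB : ‖v bigCell p‖ ≤
      K * 2 ^ m 1 * ((1 + ‖p 1‖) ^ m 1)⁻¹ * 2 ^ m 0 * ((1 + ‖p 0‖) ^ m 0)⁻¹ := by
    refine le_of_flip (by positivity) (hA _ rfl p) fun h1 => ⟨_, ?_, h _ 0 p rfl (ne_zero h1)⟩
    have h2 := hA (Function.update bigCell 0 true) rfl (flip 0 p) (norm_flip_self_le h1)
    have h3 : flip 0 p 1 = p 1 := by simp [flip]
    rwa [h3] at h2
  refine hB.trans (le_of_eq ?_)
  rw [Fin.prod_univ_two]
  ring

/-- The exponent `3` suffices since `ℂ` has real dimension `2`. -/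
theorem integrable_decay {m : Fin 2 → ℕ} (hm : ∀ i, 3 ≤ m i) :
    Integrable (fun p : Pt => ∏ i, ((1 + ‖p i‖) ^ m i)⁻¹) := by
  refine Integrable.fintype_prod (f := fun i (z : ℂ) => ((1 + ‖z‖) ^ m i)⁻¹) fun i => ?_
  have h := integrable_one_add_norm (E := ℂ) (μ := volume) (r := m i) (by
    rw [Complex.finrank_real_complex]
    have := hm i
    exact_mod_cast this)
  refine h.congr (ae_of_all _ fun z => ?_)
  simp only
  rw [Real.rpow_neg (by positivity), Real.rpow_natCast]

theorem continuous_wirtinger (k : Fin 2) {u : Pt → ℂ} (hu : ContDiff ℝ ∞ u) :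
    Continuous (wirtinger k u) := by
  have h : ContDiff ℝ ∞ (wirtinger k u) := wirtinger_mem k ⟨u, hu⟩
  exact h.continuous

theorem integral_wirtinger_of_hasCompactSupport (k : Fin 2) {h : Pt → ℂ} (hs : ContDiff ℝ ∞ h)
    (hc : HasCompactSupport h) : ∫ p, wirtinger k h p = 0 := by
  have hd : Differentiable ℝ h := hs.differentiable (by simp)
  have hcont : Continuous (fderiv ℝ h) := hs.continuous_fderiv (by simp)
  have hi : ∀ v, Integrable (fun p => fderiv ℝ h p v) := fun v =>
    (hcont.clm_apply continuous_const).integrable_of_hasCompactSupport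
      (hc.fderiv_apply (𝕜 := ℝ) v)
  have h0 : ∀ v, ∫ p, fderiv ℝ h p v = 0 := by
    intro v
    have := integral_mul_fderiv_eq_neg_fderiv_mul_of_integrable (𝕜 := ℂ) (μ := volume)
      (f := fun _ : Pt => (1 : ℂ)) (g := h) (v := v) (by simp) (by simpa using hi v)
      (by simpa using hs.continuous.integrable_of_hasCompactSupport hc)
      (fun _ _ => differentiableAt_const _) (fun x _ => hd x)
    simpa using this
  simp only [wirtinger]
  rw [integral_div, integral_add (hi _) ((hi _).const_mul _), integral_const_mul, h0, h0]
  simp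

theorem exists_cutoff : ∃ ρ : Pt → ℂ, ContDiff ℝ ∞ ρ ∧ HasCompactSupport ρ ∧ ρ 0 = 1 ∧
    ∀ p, ‖ρ p‖ ≤ 1 := by
  let b : ContDiffBump (0 : Pt) := ⟨1, 2, one_pos, one_lt_two⟩
  refine ⟨fun p => (b p : ℂ), Complex.ofRealCLM.contDiff.comp b.contDiff,
    b.hasCompactSupport.comp_left (g := fun x : ℝ => (x : ℂ)) Complex.ofReal_zero, ?_, fun p => ?_⟩
  · have : b 0 = 1 := b.one_of_mem_closedBall (Metric.mem_closedBall_self b.rIn_pos.le)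
    simp [this]
  · rw [Complex.norm_real, Real.norm_of_nonneg b.nonneg]
    exact b.le_one

/-- The divergence theorem for functions that decay slightly too slowly to be integrable. -/
theorem integral_wirtinger_eq_zero (k : Fin 2) {u : Pt → ℂ} (hu : ContDiff ℝ ∞ u)
    (h1 : Integrable fun p => (1 + ‖p‖)⁻¹ * ‖u p‖) (h2 : Integrable (wirtinger k u)) :
    ∫ p, wirtinger k u p = 0 := by
  obtain ⟨ρ, hρ, hc, hρ0, hρ1⟩ := exists_cutoff
  have hdu : Differentiable ℝ u := hu.differentiable (by simp)
  have hdρ : Differentiable ℝ ρ := hρ.differentiable (by simp)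
  -- the derivative of the cutoff is `O(1 / |q|)`
  obtain ⟨C, hC⟩ : ∃ C, ∀ q : Pt, ‖((1 + ‖q‖ : ℝ) : ℂ) * wirtinger k ρ q‖ ≤ C := by
    refine HasCompactSupport.exists_bound_of_continuous ?_ ?_
    · refine HasCompactSupport.mul_left ?_
      have : ∀ v, HasCompactSupport fun p => fderiv ℝ ρ p v := fun v => hc.fderiv_apply (𝕜 := ℝ) v
      have h3 := ((this (Pi.single k 1)).add ((this (Pi.single k Complex.I)).mul_left
        (f := fun _ => Complex.I))).mul_right (f' := fun _ => (2 : ℂ)⁻¹)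
      exact h3
    · exact (Complex.continuous_ofReal.comp (by fun_prop)).mul (continuous_wirtinger k hρ)
  have hC0 : 0 ≤ C := (norm_nonneg _).trans (hC 0)
  let t : ℕ → ℝ := fun n => ((n : ℝ) + 1)⁻¹
  have ht0 : ∀ n, 0 < t n := fun n => by positivity
  have ht1 : ∀ n, t n ≤ 1 := fun n => inv_le_one_of_one_le₀ (by simp)
  have htt : Tendsto t atTop (𝓝 0) := by
    simpa [t, one_div] using tendsto_one_div_add_atTop_nhds_zero_nat (𝕜 := ℝ)
  let χ : ℕ → Pt → ℂ := fun n p => ρ (t n • p)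
  have hχ : ∀ n, ContDiff ℝ ∞ (χ n) := fun n => hρ.comp (contDiff_const_smul (t n))
  have hχc : ∀ n, HasCompactSupport (χ n) := fun n => hc.comp_smul (ht0 n).ne'
  have hχw : ∀ n p, wirtinger k (χ n) p = t n * wirtinger k ρ (t n • p) := by
    intro n p
    have : fderiv ℝ (χ n) p = t n • fderiv ℝ ρ (t n • p) := fderiv_comp_smul (f := ρ) (t n)
    simp only [wirtinger, this, smul_apply, Complex.real_smul]
    ring
  have hdχ : ∀ n, Differentiable ℝ (χ n) := fun n => (hχ n).differentiable (by simp)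
  have hχb : ∀ n p, ‖wirtinger k (χ n) p‖ ≤ C * (1 + ‖p‖)⁻¹ := by
    intro n p
    have h3 := hC (t n • p)
    have h4 : 0 < 1 + ‖t n • p‖ := by positivity
    rw [norm_mul, Complex.norm_real, Real.norm_of_nonneg h4.le] at h3
    rw [hχw, norm_mul, Complex.norm_real, Real.norm_of_nonneg (ht0 n).le, ← div_eq_mul_inv,
      le_div_iff₀ (by positivity)]
    calc t n * ‖wirtinger k ρ (t n • p)‖ * (1 + ‖p‖)
        = (t n + t n * ‖p‖) * ‖wirtinger k ρ (t n • p)‖ := by ring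
      _ ≤ (1 + ‖t n • p‖) * ‖wirtinger k ρ (t n • p)‖ := by
        refine mul_le_mul_of_nonneg_right ?_ (norm_nonneg _)
        rw [norm_smul, Real.norm_of_nonneg (ht0 n).le]
        exact add_le_add_left (ht1 n) _
      _ ≤ C := h3
  -- `F n` is `∂̄_k` of the compactly supported function `χ n * u`
  let F : ℕ → Pt → ℂ := fun n p => wirtinger k (χ n) p * u p + χ n p * wirtinger k u p
  have hF : ∀ n, ∫ p, F n p = 0 := by
    intro n
    rw [← integral_wirtinger_of_hasCompactSupport k ((hχ n).mul hu) (hχc n).mul_right]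
    exact integral_congr_ae (ae_of_all _ fun p => (wirtinger_mul (hdχ n p) (hdu p)).symm)
  have hlim : Tendsto (fun n => ∫ p, F n p) atTop (𝓝 (∫ p, wirtinger k u p)) := by
    refine tendsto_integral_of_dominated_convergence
      (fun p => C * ((1 + ‖p‖)⁻¹ * ‖u p‖) + ‖wirtinger k u p‖) (fun n => ?_)
      ((h1.const_mul C).add h2.norm) (fun n => ae_of_all _ fun p => ?_) (ae_of_all _ fun p => ?_)
    · exact (((continuous_wirtinger k (hχ n)).mul hu.continuous).add
        ((hχ n).continuous.mul (continuous_wirtinger k hu))).aestronglyMeasurable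
    · refine (norm_add_le _ _).trans (add_le_add ?_ ?_)
      · rw [norm_mul, ← mul_assoc]
        exact mul_le_mul_of_nonneg_right (hχb n p) (norm_nonneg _)
      · rw [norm_mul]
        exact mul_le_of_le_one_left (norm_nonneg _) (hρ1 _)
    · have h3 : Tendsto (fun n => t n • p) atTop (𝓝 0) := by
        simpa using htt.smul_const p
      have h4 : Tendsto (fun n => χ n p) atTop (𝓝 1) := by
        have := (hρ.continuous.tendsto 0).comp h3
        rwa [hρ0] at this
      have h5 : Tendsto (fun n => wirtinger k (χ n) p) atTop (𝓝 0) := by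
        have h6 := ((continuous_wirtinger k hρ).tendsto 0).comp h3
        have h7 := ((Complex.continuous_ofReal.tendsto 0).comp htt).mul h6
        simp only [Complex.ofReal_zero, zero_mul] at h7
        exact h7.congr fun n => (hχw n p).symm
      simpa using (h5.mul_const (u p)).add (h4.mul_const (wirtinger k u p))
  simp only [hF] at hlim
  exact tendsto_nhds_unique hlim tendsto_const_nhds

/-! ### Integration over `ΠF` -/

theorem norm_kappa_mul_star (i : Fin 2) (p : Pt) :
    ‖kappa i p * star (kappa i p)‖ = (‖p i‖ ^ 4)⁻¹ := by
  rw [norm_mul, norm_star, kappa, norm_inv, norm_pow, ← mul_inv, ← pow_add]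

theorem integrand_mu (a : Chart → Loc) (p : Pt) :
    integrand a mu p = topCoeff (ev p (a bigCell)) := by
  rw [integrand, ev_mu, topCoeff_apply]

theorem contDiff_ev (φ : Module.Dual ℂ Gr) (σ : Loc) : ContDiff ℝ ∞ fun p => φ (ev p σ) := by
  have h : ContDiff ℝ ∞ (comp φ σ).1 := (comp φ σ).2
  have h2 : (comp φ σ).1 = fun p => φ (ev p σ) := funext fun p => comp_apply φ σ p
  rwa [h2] at h

theorem integrable_integrand_mu {a : Chart → Loc} (ha : a ∈ Dolb) :
    Integrable (integrand a mu) := by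
  obtain ⟨C, hC, h⟩ := exists_decay (v := fun c p => topCoeff (ev p (a c)))
    (fun c => (contDiff_ev topCoeff (a c)).continuous) (fun _ => 4) (by
      intro c i p hc hp
      rw [glued_of_mem_Dolb ha c i p hc hp, one_smul, topCoeff_formT hp, norm_mul,
        norm_kappa_mul_star])
  have he : integrand a mu = fun p => topCoeff (ev p (a bigCell)) :=
    funext fun p => integrand_mu a p
  rw [he]
  exact ((integrable_decay (m := fun _ => 4) (by simp)).const_mul C).mono'
    (contDiff_ev topCoeff _).continuous.aestronglyMeasurable (ae_of_all _ h)

theorem superInt_add {a b : Chart → Loc} (ha : a ∈ Dolb) (hb : b ∈ Dolb) :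
    superInt (a + b) mu = superInt a mu + superInt b mu := by
  have h : integrand (a + b) mu = fun p => integrand a mu p + integrand b mu p := by
    funext p
    simp only [integrand_mu, Pi.add_apply, map_add]
  rw [superInt, h, integral_add (integrable_integrand_mu ha) (integrable_integrand_mu hb), mul_add]
  rfl

theorem superInt_smul (r : ℂ) (a : Chart → Loc) : superInt (r • a) mu = r * superInt a mu := by
  have h : integrand (r • a) mu = fun p => r * integrand a mu p := by
    funext p
    simp only [integrand_mu, Pi.smul_apply, map_smul, smul_eq_mul]
  rw [superInt, h, integral_const_mul, mul_left_comm]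
  rfl

/-- The integral `∫ a μ` as a linear functional on the Dolbeault algebra. -/
def intMu : Dolb →ₗ[ℂ] ℂ where
  toFun a := superInt a.1 mu
  map_add' a b := superInt_add a.2 b.2
  map_smul' r a := superInt_smul r a.1

/-! ### The integral of a `D`-exact form vanishes -/

/-- The coefficient of `θ_0 … θ_6 dz̄_l`, `l ≠ k`, up to sign. -/
def subtopCoeff (k : Fin 2) : Gr →ₗ[ℂ] ℂ := topCoeff ∘ₗ LinearMap.mulLeft ℂ (xi k)

theorem subtopCoeff_apply (k : Fin 2) (x : Gr) : subtopCoeff k x = topCoeff (xi k * x) := rfl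

/-- The transition factor of `subtopCoeff k` along the `i`-th factor of `X`. -/
def subtopFactor (k i : Fin 2) (p : Pt) : ℂ := kappa i p * if k = i then 1 else star (kappa i p)

theorem subtopCoeff_formT {i : Fin 2} {p : Pt} (hp : p i ≠ 0) (k : Fin 2) (x : Gr) :
    subtopCoeff k (formT i p x) = subtopFactor k i p * subtopCoeff k x := by
  have h := topCoeff_formT hp (xi k * x)
  have h2 : formT i p (xi k * x) =
      (if k = i then star (kappa i p) else 1) • (xi k * formT i p x) :=
    formT_oddGen_mul i p _ x
  rw [h2, map_smul, smul_eq_mul] at h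
  rw [subtopCoeff_apply, subtopCoeff_apply, subtopFactor]
  by_cases hk : k = i
  · simp only [hk, if_true] at h ⊢
    apply mul_left_cancel₀ (star_ne_zero.2 (kappa_ne_zero hp))
    rw [h]
    ring
  · simp only [hk, if_false, one_mul] at h ⊢
    exact h

theorem norm_subtopFactor (k i : Fin 2) (p : Pt) :
    ‖subtopFactor k i p‖ = (‖p i‖ ^ (if i = k then 2 else 4))⁻¹ := by
  by_cases hk : k = i
  · simp [subtopFactor, hk, kappa]
  · simp only [subtopFactor, if_neg hk, if_neg (Ne.symm hk), norm_kappa_mul_star]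

theorem wirtinger_subtopFactor {i : Fin 2} {p : Pt} (hp : p i ≠ 0) (k : Fin 2) :
    DifferentiableAt ℝ (subtopFactor k i) p ∧ wirtinger k (subtopFactor k i) p = 0 := by
  have hd : HasDerivAt (fun z : ℂ => (z ^ 2)⁻¹) _ (p i) :=
    (hasDerivAt_pow 2 (p i)).fun_inv (pow_ne_zero 2 hp)
  have h1 := holomorphic_coord hd
  have h2 := antiholomorphic_coord hd
  by_cases hk : k = i
  · have : subtopFactor k i = fun q : Pt => (q i ^ 2)⁻¹ := by
      funext q
      simp [subtopFactor, hk, kappa]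
    rw [this]
    exact ⟨h1.1, h1.2 k⟩
  · have : subtopFactor k i = fun q : Pt => (q i ^ 2)⁻¹ * star ((q i ^ 2)⁻¹) := by
      funext q
      simp [subtopFactor, hk, kappa]
    rw [this]
    refine ⟨h1.1.mul h2.1, ?_⟩
    rw [wirtinger_mul h1.1 h2.1, h1.2, h2.2, if_neg hk, zero_mul, mul_zero, add_zero]

/-- `∂/∂z̄_k` of the coefficient of `θ_0 … θ_6 dz̄_l`, `l ≠ k`, transforms as a top form. -/
theorem wirtinger_subtopCoeff {b : Chart → Loc} (hb : b ∈ Dolb) (k : Fin 2) {c : Chart}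
    {i : Fin 2} {p : Pt} (hc : c i = false) (hp : p i ≠ 0) :
    wirtinger k (fun q => subtopCoeff k (ev q (b c))) p = kappa i p * star (kappa i p) *
      wirtinger k (fun q => subtopCoeff k (ev q (b (Function.update c i true)))) (flip i p) := by
  have he : (fun q => subtopCoeff k (ev q (b c))) =ᶠ[nhds p] fun q => subtopFactor k i q *
      (fun q => subtopCoeff k (ev q (b (Function.update c i true)))) (flip i q) := by
    have hopen : ∀ᶠ q : Pt in nhds p, q i ≠ 0 :=
      (continuous_apply i).continuousAt.eventually_ne hp
    filter_upwards [hopen] with q hq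
    rw [glued_of_mem_Dolb hb c i q hc hq, one_smul, subtopCoeff_formT hq]
  obtain ⟨h1, h2⟩ := wirtinger_subtopFactor hp k
  obtain ⟨h3, h4⟩ := wirtinger_comp_flip hp ((contDiff_ev (subtopCoeff k)
    (b (Function.update c i true))).differentiable (by simp))
  rw [wirtinger_congr he, wirtinger_mul h1 h3, h2, h4, zero_mul, zero_add, subtopFactor]
  split_ifs <;> ring

theorem integrable_wirtinger_subtopCoeff {b : Chart → Loc} (hb : b ∈ Dolb) (k : Fin 2) :
    Integrable (wirtinger k fun q => subtopCoeff k (ev q (b bigCell))) := by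
  have hcont : ∀ c, Continuous (wirtinger k fun q => subtopCoeff k (ev q (b c))) := fun c =>
    continuous_wirtinger k (contDiff_ev _ _)
  obtain ⟨C, hC, h⟩ := exists_decay
    (v := fun c => wirtinger k fun q => subtopCoeff k (ev q (b c))) hcont (fun _ => 4) (by
      intro c i p hc hp
      rw [wirtinger_subtopCoeff hb k hc hp, norm_mul, norm_kappa_mul_star])
  exact ((integrable_decay (m := fun _ => 4) (by simp)).const_mul C).mono'
    (hcont _).aestronglyMeasurable (ae_of_all _ h)

/-- Stokes' theorem for one component of a form: the coefficient of `θ_0 … θ_6 dz̄_l` decays only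
like `|z_k|⁻²`, which is not integrable but sufficient. -/
theorem integral_wirtinger_subtopCoeff {b : Chart → Loc} (hb : b ∈ Dolb) (k : Fin 2) :
    ∫ p, wirtinger k (fun q => subtopCoeff k (ev q (b bigCell))) p = 0 := by
  have hcd := contDiff_ev (subtopCoeff k) (b bigCell)
  refine integral_wirtinger_eq_zero k hcd ?_ (integrable_wirtinger_subtopCoeff hb k)
  obtain ⟨C, hC, h⟩ := exists_decay (v := fun c p => subtopCoeff k (ev p (b c)))
    (fun c => (contDiff_ev (subtopCoeff k) (b c)).continuous) (fun i => if i = k then 2 else 4) (by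
      intro c i p hc hp
      rw [glued_of_mem_Dolb hb c i p hc hp, one_smul, subtopCoeff_formT hp, norm_mul,
        norm_subtopFactor])
  have hint := (integrable_decay (m := fun i => if i = k then 3 else 4)
    (by intro i; split_ifs <;> norm_num)).const_mul C
  refine hint.mono' ?_ (ae_of_all _ fun p => ?_)
  · exact ((Continuous.inv₀ (by fun_prop) fun p => by positivity).mul
      hcd.continuous.norm).aestronglyMeasurable
  · have hk : (1 + ‖p‖)⁻¹ ≤ (1 + ‖p k‖)⁻¹ :=
      inv_anti₀ (by positivity) (add_le_add_right (norm_le_pi_norm p k) 1)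
    rw [Real.norm_of_nonneg (by positivity)]
    calc (1 + ‖p‖)⁻¹ * ‖subtopCoeff k (ev p (b bigCell))‖
        ≤ (1 + ‖p k‖)⁻¹ * (C * ∏ i, ((1 + ‖p i‖) ^ (if i = k then 2 else 4))⁻¹) :=
          mul_le_mul hk (h p) (norm_nonneg _) (by positivity)
      _ = C * ∏ i, ((1 + ‖p i‖) ^ (if i = k then 3 else 4))⁻¹ := by
          rw [Fin.prod_univ_two, Fin.prod_univ_two]
          have e : ∀ x : ℝ, ((1 + x) ^ 3)⁻¹ = (1 + x)⁻¹ * ((1 + x) ^ 2)⁻¹ := fun x => by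
            rw [pow_succ', mul_inv]
          fin_cases k
          · simp [e]
            ring
          · simp [e]
            ring

theorem topCoeff_dForm {W : Chart → Loc} (hW : RepresentsFundamentalClass W) (b : Chart → Loc)
    (p : Pt) : topCoeff (ev p (dForm W b bigCell)) =
      ∑ k, wirtinger k (fun q => subtopCoeff k (ev q (b bigCell))) p := by
  have h1 : topCoeff (dbarFib (ev p (b bigCell))) = 0 := by
    rw [dbarFib_apply, map_sum]
    exact Finset.sum_eq_zero fun j _ => topCoeff_eta_mul _ _
  rw [ev_dForm, map_add, topCoeff_alpha (ev_mem_wFibre hW _ _), add_zero, ev_dbar, map_add, h1,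
    add_zero, map_sum]
  exact Finset.sum_congr rfl fun k _ => ((hasDbar_ev (b bigCell) p (subtopCoeff k)).2 k).symm

theorem superInt_dForm {W : Chart → Loc} (hW : RepresentsFundamentalClass W) {b : Chart → Loc}
    (hb : b ∈ Dolb) : superInt (dForm W b) mu = 0 := by
  have h : integrand (dForm W b) mu = fun p =>
      ∑ k, wirtinger k (fun q => subtopCoeff k (ev q (b bigCell))) p :=
    funext fun p => by rw [integrand_mu, topCoeff_dForm hW]
  rw [superInt, h, integral_finsetSum _ fun k _ => integrable_wirtinger_subtopCoeff hb k]
  simp [integral_wirtinger_subtopCoeff hb]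

/-! ### The trace property -/

theorem parityGr_ev {k : ℕ} {σ : Chart → Loc} (h : HasParity k σ) (c : Chart) (p : Pt) :
    parityGr (ev p (σ c)) = (-1 : ℂ) ^ k • ev p (σ c) := by
  have := congrArg (ev p) (h c)
  rwa [ev_onGr, map_smul] at this

theorem superInt_mul_comm {k l : ℕ} {a b : Chart → Loc} (ha : HasParity k a)
    (hb : HasParity l b) : superInt (a * b) mu = (-1) ^ (k * l) * superInt (b * a) mu := by
  have h : integrand (a * b) mu = fun p => (-1 : ℂ) ^ (k * l) * integrand (b * a) mu p := by
    funext p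
    rw [integrand_mu, integrand_mu, Pi.mul_apply, Pi.mul_apply, map_mul (ev p), map_mul (ev p),
      mul_supercomm (parityGr_ev ha _ _) (parityGr_ev hb _ _), map_smul, smul_eq_mul]
  rw [superInt, h, integral_const_mul, superInt]
  ring

/-! ### A closed form with nonzero integral -/

/-- The Fubini–Study density `∏ (1 + |z_i|²)⁻²`. -/
def fubiniStudy (p : Pt) : ℝ := ∏ i, ((1 + ‖p i‖ ^ 2) ^ 2)⁻¹

theorem fubiniStudy_pos (p : Pt) : 0 < fubiniStudy p :=
  Finset.prod_pos fun i _ => by positivity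

theorem contDiff_fubiniStudy : ContDiff ℝ ∞ fubiniStudy := by
  unfold fubiniStudy
  refine contDiff_prod fun i _ => ContDiff.inv ?_ fun p => by positivity
  exact (contDiff_const.add ((contDiff_apply ℝ ℂ i).norm_sq ℝ)).pow 2

theorem fubiniStudy_flip {i : Fin 2} {p : Pt} (hp : p i ≠ 0) :
    fubiniStudy p = (‖p i‖ ^ 4)⁻¹ * fubiniStudy (flip i p) := by
  have hn : ‖p i‖ ≠ 0 := norm_ne_zero_iff.2 hp
  have key : ((1 + ‖p i‖ ^ 2) ^ 2)⁻¹ = (‖p i‖ ^ 4)⁻¹ * ((1 + ‖-(p i)⁻¹‖ ^ 2) ^ 2)⁻¹ := by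
    rw [norm_neg, norm_inv]
    field_simp
    ring
  unfold fubiniStudy
  rw [Fin.prod_univ_two, Fin.prod_univ_two]
  fin_cases i
  · simp only [Fin.zero_eta] at key ⊢
    rw [key, flip_self, flip, Function.update_of_ne (by decide), mul_assoc]
  · simp only [Fin.mk_one] at key ⊢
    rw [key, flip_self, flip, Function.update_of_ne (by decide), mul_left_comm]

/-- The form `∏ (1 + |z_i|²)⁻² θ_0 … θ_6 dz̄_0 dz̄_1`, given by the same formula in each patch. -/
def volForm : Chart → Loc := fun _ =>
  (⟨fun p => (fubiniStudy p : ℂ), Complex.ofRealCLM.contDiff.comp contDiff_fubiniStudy⟩ : Sm)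
    ⊗ₜ[ℂ] topMon

theorem ev_volForm (c : Chart) (p : Pt) : ev p (volForm c) = (fubiniStudy p : ℂ) • topMon :=
  ev_tmul _ _ _

theorem formT_topMon {i : Fin 2} {p : Pt} (hp : p i ≠ 0) :
    formT i p topMon = (kappa i p * star (kappa i p)) • topMon := by
  rw [formT_eq, topMon, rescale_oddMon, map_smul, shearForm_apply]
  simp only [dEta_oddMon, mul_zero, smul_zero, Finset.sum_const_zero, add_zero]
  rw [List.map_append, List.prod_append, thList_map_prod, xiList_map_prod]
  congr 2
  · exact prod_gFun hp
  · fin_cases i <;> simp [oddScale]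

theorem volForm_mem_Dolb : volForm ∈ Dolb := by
  intro c i p _ hp
  rw [ev_volForm, ev_volForm, map_smul, formT_topMon hp, one_smul, smul_smul, fubiniStudy_flip hp]
  congr 1
  have h : kappa i p * star (kappa i p) = (((‖p i‖ ^ 4)⁻¹ : ℝ) : ℂ) := by
    rw [← norm_kappa_mul_star, norm_mul, norm_star]
    have := Complex.mul_conj' (kappa i p)
    push_cast
    rw [← sq]
    exact this
  rw [h]
  push_cast
  ring

theorem xi_mul_topMon (k : Fin 2) : xi k * topMon = 0 :=
  oddGen_mul_oddMon_of_mem (List.mem_append_right _ (xi_mem k))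

theorem mul_eq_zero_of_mem_wFibre {w : Gr} (hw : w ∈ wFibre) (x : Gr) (h0 : ∀ k, xi k * x = 0) :
    w * x = 0 := by
  induction hw using Submodule.span_induction with
  | mem w hw =>
    obtain ⟨⟨a, b⟩, rfl⟩ := hw
    simp [mul_assoc, h0]
  | zero => simp
  | add u v _ _ hu hv => rw [add_mul, hu, hv, add_zero]
  | smul r u _ hu => rw [smul_mul_assoc, hu, smul_zero]

theorem dForm_volForm {W : Chart → Loc} (hW : RepresentsFundamentalClass W) :
    dForm W volForm = 0 := by
  funext c
  refine loc_ext fun p => ?_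
  have h1 : dbarFib topMon = 0 := by
    have : ∀ j, dTb j topMon = 0 := by
      intro j
      refine dOdd_oddMon_of_notMem ?_
      simp [thList, xiList]
    simp [dbarFib_apply, this]
  have h2 : ∀ k, xi k * dOdd (Sum.inl 6) topMon = 0 := by
    intro k
    have := dOdd_oddGen_mul (Sum.inl 6) (Sum.inr (Sum.inr k)) topMon
    rw [show oddGen (Sum.inr (Sum.inr k)) * topMon = 0 from xi_mul_topMon k, map_zero,
      if_neg (by simp), zero_sub, eq_comm, neg_eq_zero] at this
    exact this
  have h3 : ∀ k, xi k * ev p (dZb k (volForm c)) = 0 := by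
    intro k
    rw [volForm, dZb, LinearMap.rTensor_tmul, ev_tmul, mul_smul_comm, xi_mul_topMon, smul_zero]
  rw [ev_dForm, ev_dbar, ev_volForm, map_smul, map_smul, h1, mul_smul_comm,
    mul_eq_zero_of_mem_wFibre (ev_mem_wFibre hW c p) _ h2]
  simp [h3]

theorem superInt_volForm_ne_zero : superInt volForm mu ≠ 0 := by
  have h : integrand volForm mu = fun p => (fubiniStudy p : ℂ) * topCoeff topMon := by
    funext p
    rw [integrand_mu, ev_volForm, map_smul, smul_eq_mul]
  have hi : Integrable fubiniStudy := by
    have h1 := integrable_integrand_mu volForm_mem_Dolb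
    rw [h, integrable_mul_const_iff (isUnit_iff_ne_zero.2 topCoeff_topMon_ne_zero)] at h1
    exact h1.re
  have hpos : 0 < ∫ p, fubiniStudy p := by
    rw [integral_pos_iff_support_of_nonneg (fun p => (fubiniStudy_pos p).le) hi]
    have : Function.support fubiniStudy = Set.univ :=
      Set.eq_univ_of_forall fun p => (fubiniStudy_pos p).ne'
    rw [this]
    exact isOpen_univ.measure_pos _ Set.univ_nonempty
  rw [superInt, h, integral_mul_const, integral_complex_ofReal]
  exact mul_ne_zero (by norm_num)
    (mul_ne_zero (Complex.ofReal_ne_zero.2 hpos.ne') topCoeff_topMon_ne_zero)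

end SplitPiF

end

theorem mainTheorem5 (W : SplitPiF.Chart → SplitPiF.Loc)
    (hW : SplitPiF.RepresentsFundamentalClass W) (n : ℕ) :
    -- `μ` is an integral form of type `(0,-2)`, `D`-closed, nonzero and not `D`-exact
    SplitPiF.IsIntForm 2 SplitPiF.mu ∧
    SplitPiF.dInt W SplitPiF.mu = 0 ∧
    SplitPiF.mu ≠ 0 ∧
    (¬ ∃ ν ∈ SplitPiF.intForms, SplitPiF.dInt W ν = SplitPiF.mu) ∧
    -- the integrals against `μ` converge
    (∀ a : SplitPiF.Dolb, MeasureTheory.Integrable (SplitPiF.integrand a.1 SplitPiF.mu)) ∧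
    -- `D` acts on `Ω^{0•}(ΠF)`
    ∃ D : SplitPiF.Dolb →ₗ[ℂ] SplitPiF.Dolb,
      (∀ a : SplitPiF.Dolb, (D a).1 = SplitPiF.dForm W a.1) ∧
      -- the functional `a ↦ ∫ a μ` is nonzero on `D`-closed forms
      (∃ a : SplitPiF.Dolb, D a = 0 ∧ SplitPiF.superInt a.1 SplitPiF.mu ≠ 0) ∧
      -- `a ↦ tr ∫ a μ` is a `D`-closed (super)trace on `Ω^{0•}(ΠF) ⊗ Mat_n`
      ∃ τ : Matrix (Fin n) (Fin n) SplitPiF.Dolb →ₗ[ℂ] ℂ,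
        (∀ a : Matrix (Fin n) (Fin n) SplitPiF.Dolb,
          τ a = ∑ i, SplitPiF.superInt (a i i).1 SplitPiF.mu) ∧
        (∀ a : Matrix (Fin n) (Fin n) SplitPiF.Dolb, τ (a.map D) = 0) ∧
        ∀ (k l : ℕ) (a b : Matrix (Fin n) (Fin n) SplitPiF.Dolb),
          (∀ i j, SplitPiF.HasParity k (a i j).1) →
          (∀ i j, SplitPiF.HasParity l (b i j).1) →
          τ (a * b) = (-1) ^ (k * l) * τ (b * a) := by
  refine ⟨SplitPiF.isIntForm_mu, SplitPiF.dInt_mu hW, SplitPiF.mu_ne_zero, ?_,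
    fun a => SplitPiF.integrable_integrand_mu a.2, SplitPiF.dDolb W hW, fun a => rfl, ?_, ?_⟩
  · rintro ⟨ν, -, h⟩
    exact SplitPiF.dInt_ne_mu hW ν h
  · exact ⟨⟨SplitPiF.volForm, SplitPiF.volForm_mem_Dolb⟩,
      Subtype.ext (SplitPiF.dForm_volForm hW), SplitPiF.superInt_volForm_ne_zero⟩
  · have hsum : ∀ a : Matrix (Fin n) (Fin n) SplitPiF.Dolb,
        (SplitPiF.intMu ∘ₗ Matrix.traceLinearMap (Fin n) ℂ SplitPiF.Dolb) a =
          ∑ i, SplitPiF.intMu (a i i) := fun a => map_sum SplitPiF.intMu _ _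
    refine ⟨SplitPiF.intMu ∘ₗ Matrix.traceLinearMap (Fin n) ℂ SplitPiF.Dolb, hsum, fun a => ?_,
      fun k l a b ha hb => ?_⟩
    · rw [hsum]
      exact Finset.sum_eq_zero fun i _ => SplitPiF.superInt_dForm hW (a i i).2
    · have hmul : ∀ i j, SplitPiF.intMu (a i j * b j i) =
          (-1) ^ (k * l) * SplitPiF.intMu (b j i * a i j) := fun i j =>
        SplitPiF.superInt_mul_comm (ha i j) (hb j i)
      rw [hsum, hsum]
      simp only [Matrix.mul_apply, map_sum, hmul, Finset.mul_sum]
      exact Finset.sum_comm
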